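/- **Definitions.** A *short skew multicategory* $\mathbb C$ consists of a category $\mathcal C$ with: functors $\mathbb C^t_n\colon(\mathcal C^n)^{op}\times\mathcal C\to\mathbf{Set}$ of *tight* $n$-ary maps for $1\le n\le 4$, where $\mathbb C^t_1=\mathcal C(-,-)$; functors $\mathbb C^l_n$ of *loose* $n$-ary maps for $0\le n\le 2$; natural maps $j_n\colon\mathbb C^t_n\to\mathbb C^l_n$ for $n=1,2$; and substitutions $$\circ_i\colon \mathbb C^x_n(b_1,\dots,b_n;c)\times\mathbb C^y_m(\overline a;b_i)\to\mathbb C^{x\circ_i y}_{n+m-1}(b_{<i},\overline a,b_{>i};c),\qquad 1\le i\le n,$$ natural in all variables other than $b_i$ and dinatural in $b_i$, where $x\circ_i y=t$ if $x=t$ and either $y=t$ or $i\ne1$, and $x\circ_iy=l$ otherwise. They are given for: tight binary into tight binary or ternary, tight ternary into tight binary, nullary into tight binary or ternary, nullary into loose unary, loose unary into tight binary, and tight binary into loose unary. For $f$ tight binary, $g$ of arity $n$ and $h$ of arity $p$ (tight unless nullary) one requires $f\circ_i(g\circ_jh)=(f\circ_ig)\circ_{i+j-1}h$ ($1\le i\le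 2$, $1\le j\le n$) for $(n,p)=(2,2),(2,0)$, and $(f\circ_1g)\circ_{n+1}h=(f\circ_2h)\circ_1g$ for $(n,p)=(2,2),(2,0),(0,2),(0,0)$. Compatibility with $j$ is also required: for $p$ tight unary, $g$ tight binary and $v$ nullary, $g\circ_2jp=g\circ_2p$, $g\circ_1jp=j(g\circ_1p)$, $jp\circ g=j(p\circ g)$, $jp\circ v=p\circ v$. A morphism is a functor together with natural families of maps on all tight and loose multimaps commuting with the substitutions and with $j$. $\mathbb C$ is *left representable* if there are a nullary map $u\in\mathbb C^l_0(\diamond;i)$ and, for all $a,b$, a tight binary map $\theta_{a,b}\in\mathbb C^t_2(a,b;ab)$ such that the maps $-\circ u\colon\mathcal C(i,d)\to\mathbb C^l_0(\diamond;d)$, $-\circ_1u\colon\mathbb C^t_{n+1}(i,\overline x;d)\to\mathbb C^l_n(\overline x;d)$ ($n=1,2$) and $-\circ_1\theta_{a,b}\colon\mathbb C^t_n(ab,\overline x;d)\to\mathbb C^t_{n+1}(a,b,\overline x;d)$ ($n=1,2,3$) are bijections. A *short braiding* on $\mathbb C$ consists of natural isomorphisms $\beta^3_2\colon\mathbb C^t_3(a_1,a_2,a_3;b)\to\mathbb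 C^t_3(a_1,a_3,a_2;b)$, $\beta^4_2\colon\mathbb C^t_4(a_1,a_2,a_3,a_4;b)\to\mathbb C^t_4(a_1,a_3,a_2,a_4;b)$ and $\beta^4_3\colon\mathbb C^t_4(a_1,a_2,a_3,a_4;b)\to\mathbb C^t_4(a_1,a_2,a_4,a_3;b)$ with $\beta^4_2\beta^4_3\beta^4_2=\beta^4_3\beta^4_2\beta^4_3$; $g\circ_1\beta^3_2(f)=\beta^4_2(g\circ_1f)$ and $g\circ_2\beta^3_2(f)=\beta^4_3(g\circ_2f)$ for $g$ tight binary and $f$ tight ternary; and $\beta^4_3(g\circ_1f)=\beta^3_2(g)\circ_1f$, $\beta^4_2\beta^4_3(g\circ_2f)=\beta^3_2(g)\circ_3f$, $\beta^4_3\beta^4_2(g\circ_3f)=\beta^3_2(g)\circ_2f$ for $g$ tight ternary and $f$ tight binary. It is a *symmetry* if $\beta^3_2\beta^3_2=1$. A morphism is *braided* if it commutes with $\beta^3_2,\beta^4_2,\beta^4_3$. Let $\mathbf{BrdShort}_{lr}$ be the category of left representable short skew multicategories with a short braiding and braided morphisms, and $\mathbf{SymShort}_{lr}$ its full subcategory of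 symmetric objects. A *(left) skew monoidal category* is a category with a functor $(a,b)\mapsto ab$, a unit $i$, and natural (not necessarily invertible) maps $\alpha\colon(ab)c\to a(bc)$, $\lambda\colon ia\to a$, $\rho\colon a\to ai$ satisfying the pentagon, $\lambda_{ab}\alpha_{i,a,b}=\lambda_a b$, $\alpha_{a,b,i}\rho_{ab}=a\rho_b$, $(a\lambda_b)\alpha_{a,i,b}(\rho_ab)=1$ and $\lambda_i\rho_i=1$. A *braiding* on it consists of natural isomorphisms $s_{x,a,b}\colon(xa)b\to(xb)a$ with $$s_{xc,a,b}\,(s_{x,a,c}b)\,s_{xa,b,c}=(s_{x,b,c}a)\,s_{xb,a,c}\,(s_{x,a,b}c),\qquad s_{x,a,bc}\,\alpha_{xa,b,c}=(\alpha_{x,b,c}a)\,s_{xb,a,c}\,(s_{x,a,b}c),$$ $$s_{x,ab,c}\,(\alpha_{x,a,b}c)=\alpha_{xc,a,b}\,(s_{x,a,c}b)\,s_{xa,b,c},\qquad (x\,s_{a,b,c})\,\alpha_{x,ab,c}\,(\alpha_{x,a,b}c)=\alpha_{x,ac,b}\,(\alpha_{x,a,c}b)\,s_{xa,b,c};$$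 it is a *symmetry* if $s_{x,b,a}=s_{x,a,b}^{-1}$. Let $\mathbf{BrdSkMon}$ be the category of braided skew monoidal categories and lax monoidal functors $(F,f_0,f_2)$ that preserve the braiding, i.e. $f_2\,(f_2\cdot Fa)\,s=F(s)\,f_2\,(f_2\cdot Fb)$ as maps $(Fx\,Fa)Fb\to F((xb)a)$; let $\mathbf{SymSkMon}$ be its full subcategory of symmetric objects. For a choice of classifiers $u,\theta_{a,b}$ in every left representable $\mathbb C$, let $K^{brd}\mathbb C$ be the braided skew monoidal category on $\mathcal C$ with tensor product $ab$, unit $i$, and structure determined by $(fg)\circ\theta_{a,b}=\theta_{a',b'}\circ(f,g)$ for $f\colon a\to a'$ and $g\colon b\to b'$, $\alpha\circ(\theta_{ab,c}\circ_1\theta_{a,b})=\theta_{a,bc}\circ_2\theta_{b,c}$, $\lambda_a\circ(\theta_{i,a}\circ_1u)=j(1_a)$, $\rho_a=\theta_{a,i}\circ_2u$ and $s_{x,a,b}\circ(\theta_{xa,b}\circ_1\theta_{x,a})=\beta^3_2(\theta_{xb,a}\circ_1\theta_{x,b})$. For a braided morphism $F$ let $K^{brd}F=(F,f_0,f_2)$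 with $f_2\circ\theta_{Fa,Fb}=F\theta_{a,b}$ and $f_0\circ u=Fu$. This is a functor, and it restricts to a functor $K^{sym}$ on symmetric objects. **Theorem.** For every choice of classifiers, the functors $$K^{brd}\colon\mathbf{BrdShort}_{lr}\to\mathbf{BrdSkMon}\qquad\text{and}\qquad K^{sym}\colon\mathbf{SymShort}_{lr}\to\mathbf{SymSkMon}$$ are equivalences of categories. -/

import Mathlib

universe v u

set_option linter.checkUnivs false

namespace ShortSkew

open CategoryTheory

/-! ### Set-valued functors of multimaps

`MultiN C` is the data of a functor `(Cⁿ)ᵒᵖ × C ⥤ Set`, unbundled: `act p₁ … pₙ q f` is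
the multimap `f` precomposed with `p₁, …, pₙ` and postcomposed with `q`. -/

/-- A functor `C ⥤ Set`, `c ↦ M(⋄; c)`. -/
structure Multi0 (C : Type u) [Category.{v} C] where
  hom : C → Type v
  act : ∀ {c c' : C}, (c ⟶ c') → hom c → hom c'
  act_id : ∀ {c : C} (f : hom c), act (𝟙 c) f = f
  act_act : ∀ {c c' c'' : C} (q : c ⟶ c') (q' : c' ⟶ c'') (f : hom c),
    act q' (act q f) = act (q ≫ q') f

/-- A functor `Cᵒᵖ × C ⥤ Set`, `(a, c) ↦ M(a; c)`. -/
structure Multi1 (C : Type u) [Category.{v} C] where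
  hom : C → C → Type v
  act : ∀ {a a' c c' : C}, (a' ⟶ a) → (c ⟶ c') → hom a c → hom a' c'
  act_id : ∀ {a c : C} (f : hom a c), act (𝟙 a) (𝟙 c) f = f
  act_act : ∀ {a a' a'' c c' c'' : C} (p : a' ⟶ a) (p' : a'' ⟶ a')
    (q : c ⟶ c') (q' : c' ⟶ c'') (f : hom a c),
    act p' q' (act p q f) = act (p' ≫ p) (q ≫ q') f

/-- A functor `(C²)ᵒᵖ × C ⥤ Set`, `(a₁, a₂, c) ↦ M(a₁, a₂; c)`. -/
structure Multi2 (C : Type u) [Category.{v} C] where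
  hom : C → C → C → Type v
  act : ∀ {a₁ a₁' a₂ a₂' c c' : C}, (a₁' ⟶ a₁) → (a₂' ⟶ a₂) → (c ⟶ c') →
    hom a₁ a₂ c → hom a₁' a₂' c'
  act_id : ∀ {a₁ a₂ c : C} (f : hom a₁ a₂ c), act (𝟙 a₁) (𝟙 a₂) (𝟙 c) f = f
  act_act : ∀ {a₁ a₁' a₁'' a₂ a₂' a₂'' c c' c'' : C}
    (p₁ : a₁' ⟶ a₁) (p₁' : a₁'' ⟶ a₁') (p₂ : a₂' ⟶ a₂) (p₂' : a₂'' ⟶ a₂')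
    (q : c ⟶ c') (q' : c' ⟶ c'') (f : hom a₁ a₂ c),
    act p₁' p₂' q' (act p₁ p₂ q f) = act (p₁' ≫ p₁) (p₂' ≫ p₂) (q ≫ q') f

/-- A functor `(C³)ᵒᵖ × C ⥤ Set`. -/
structure Multi3 (C : Type u) [Category.{v} C] where
  hom : C → C → C → C → Type v
  act : ∀ {a₁ a₁' a₂ a₂' a₃ a₃' c c' : C}, (a₁' ⟶ a₁) → (a₂' ⟶ a₂) → (a₃' ⟶ a₃) →
    (c ⟶ c') → hom a₁ a₂ a₃ c → hom a₁' a₂' a₃' c'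
  act_id : ∀ {a₁ a₂ a₃ c : C} (f : hom a₁ a₂ a₃ c),
    act (𝟙 a₁) (𝟙 a₂) (𝟙 a₃) (𝟙 c) f = f
  act_act : ∀ {a₁ a₁' a₁'' a₂ a₂' a₂'' a₃ a₃' a₃'' c c' c'' : C}
    (p₁ : a₁' ⟶ a₁) (p₁' : a₁'' ⟶ a₁') (p₂ : a₂' ⟶ a₂) (p₂' : a₂'' ⟶ a₂')
    (p₃ : a₃' ⟶ a₃) (p₃' : a₃'' ⟶ a₃') (q : c ⟶ c') (q' : c' ⟶ c'') (f : hom a₁ a₂ a₃ c),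
    act p₁' p₂' p₃' q' (act p₁ p₂ p₃ q f) =
      act (p₁' ≫ p₁) (p₂' ≫ p₂) (p₃' ≫ p₃) (q ≫ q') f

/-- A functor `(C⁴)ᵒᵖ × C ⥤ Set`. -/
structure Multi4 (C : Type u) [Category.{v} C] where
  hom : C → C → C → C → C → Type v
  act : ∀ {a₁ a₁' a₂ a₂' a₃ a₃' a₄ a₄' c c' : C}, (a₁' ⟶ a₁) → (a₂' ⟶ a₂) → (a₃' ⟶ a₃) →
    (a₄' ⟶ a₄) → (c ⟶ c') → hom a₁ a₂ a₃ a₄ c → hom a₁' a₂' a₃' a₄' c'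
  act_id : ∀ {a₁ a₂ a₃ a₄ c : C} (f : hom a₁ a₂ a₃ a₄ c),
    act (𝟙 a₁) (𝟙 a₂) (𝟙 a₃) (𝟙 a₄) (𝟙 c) f = f
  act_act : ∀ {a₁ a₁' a₁'' a₂ a₂' a₂'' a₃ a₃' a₃'' a₄ a₄' a₄'' c c' c'' : C}
    (p₁ : a₁' ⟶ a₁) (p₁' : a₁'' ⟶ a₁') (p₂ : a₂' ⟶ a₂) (p₂' : a₂'' ⟶ a₂')
    (p₃ : a₃' ⟶ a₃) (p₃' : a₃'' ⟶ a₃') (p₄ : a₄' ⟶ a₄) (p₄' : a₄'' ⟶ a₄')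
    (q : c ⟶ c') (q' : c' ⟶ c'') (f : hom a₁ a₂ a₃ a₄ c),
    act p₁' p₂' p₃' p₄' q' (act p₁ p₂ p₃ p₄ q f) =
      act (p₁' ≫ p₁) (p₂' ≫ p₂) (p₃' ≫ p₃) (p₄' ≫ p₄) (q ≫ q') f

instance (C : Type u) [Category.{v} C] : CoeFun (Multi0 C) (fun _ => C → Type v) := ⟨Multi0.hom⟩
instance (C : Type u) [Category.{v} C] : CoeFun (Multi1 C) (fun _ => C → C → Type v) :=
  ⟨Multi1.hom⟩
instance (C : Type u) [Category.{v} C] : CoeFun (Multi2 C) (fun _ => C → C → C → Type v) :=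
  ⟨Multi2.hom⟩
instance (C : Type u) [Category.{v} C] : CoeFun (Multi3 C) (fun _ => C → C → C → C → Type v) :=
  ⟨Multi3.hom⟩
instance (C : Type u) [Category.{v} C] :
    CoeFun (Multi4 C) (fun _ => C → C → C → C → C → Type v) :=
  ⟨Multi4.hom⟩

/-! ### Short skew multicategories -/

/-- The structure of a short skew multicategory on a category `C`.

`T2, T3, T4` are the tight multimaps (tight unary maps are the morphisms of `C`), `L0, L1, L2` the
loose ones, `j1, j2` the comparisons. The substitutions `x ∘ᵢ y` are called
`bb₁ bb₂` (tight binary into tight binary), `tb₁ tb₂ tb₃` (tight binary into tight ternary),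
`bt₁ bt₂` (tight ternary into tight binary), `bn₁ bn₂` (nullary into tight binary),
`tn₁ tn₂ tn₃` (nullary into tight ternary), `un` (nullary into loose unary),
`bu₁ bu₂` (loose unary into tight binary), `ub` (tight binary into loose unary); the first
argument is the multimap that is substituted into, the index is the position. -/
structure ShortSkewMulti (C : Type u) [Category.{v} C] where
  T2 : Multi2 C
  T3 : Multi3 C
  T4 : Multi4 C
  L0 : Multi0 C
  L1 : Multi1 C
  L2 : Multi2 C
  j1 : ∀ {a c : C}, (a ⟶ c) → L1 a c
  j2 : ∀ {a b c : C}, T2 a b c → L2 a b c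
  bb₁ : ∀ {a₁ a₂ b₁ b₂ c : C}, T2 b₁ b₂ c → T2 a₁ a₂ b₁ → T3 a₁ a₂ b₂ c
  bb₂ : ∀ {a₁ a₂ b₁ b₂ c : C}, T2 b₁ b₂ c → T2 a₁ a₂ b₂ → T3 b₁ a₁ a₂ c
  tb₁ : ∀ {a₁ a₂ b₁ b₂ b₃ c : C}, T3 b₁ b₂ b₃ c → T2 a₁ a₂ b₁ → T4 a₁ a₂ b₂ b₃ c
  tb₂ : ∀ {a₁ a₂ b₁ b₂ b₃ c : C}, T3 b₁ b₂ b₃ c → T2 a₁ a₂ b₂ → T4 b₁ a₁ a₂ b₃ c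
  tb₃ : ∀ {a₁ a₂ b₁ b₂ b₃ c : C}, T3 b₁ b₂ b₃ c → T2 a₁ a₂ b₃ → T4 b₁ b₂ a₁ a₂ c
  bt₁ : ∀ {a₁ a₂ a₃ b₁ b₂ c : C}, T2 b₁ b₂ c → T3 a₁ a₂ a₃ b₁ → T4 a₁ a₂ a₃ b₂ c
  bt₂ : ∀ {a₁ a₂ a₃ b₁ b₂ c : C}, T2 b₁ b₂ c → T3 a₁ a₂ a₃ b₂ → T4 b₁ a₁ a₂ a₃ c
  bn₁ : ∀ {b₁ b₂ c : C}, T2 b₁ b₂ c → L0 b₁ → L1 b₂ c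
  bn₂ : ∀ {b₁ b₂ c : C}, T2 b₁ b₂ c → L0 b₂ → (b₁ ⟶ c)
  tn₁ : ∀ {b₁ b₂ b₃ c : C}, T3 b₁ b₂ b₃ c → L0 b₁ → L2 b₂ b₃ c
  tn₂ : ∀ {b₁ b₂ b₃ c : C}, T3 b₁ b₂ b₃ c → L0 b₂ → T2 b₁ b₃ c
  tn₃ : ∀ {b₁ b₂ b₃ c : C}, T3 b₁ b₂ b₃ c → L0 b₃ → T2 b₁ b₂ c
  un : ∀ {b c : C}, L1 b c → L0 b → L0 c
  bu₁ : ∀ {a b₁ b₂ c : C}, T2 b₁ b₂ c → L1 a b₁ → L2 a b₂ c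
  bu₂ : ∀ {a b₁ b₂ c : C}, T2 b₁ b₂ c → L1 a b₂ → T2 b₁ a c
  ub : ∀ {a₁ a₂ b c : C}, L1 b c → T2 a₁ a₂ b → L2 a₁ a₂ c
  -- naturality of the comparisons
  j1_nat : ∀ {a a' c c' : C} (p : a' ⟶ a) (q : c ⟶ c') (f : a ⟶ c),
    j1 (p ≫ f ≫ q) = L1.act p q (j1 f)
  j2_nat : ∀ {a a' b b' c c' : C} (p₁ : a' ⟶ a) (p₂ : b' ⟶ b) (q : c ⟶ c') (f : T2 a b c),
    j2 (T2.act p₁ p₂ q f) = L2.act p₁ p₂ q (j2 f)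
  -- substitution of, and into, a tight unary map viewed as loose
  bu₂_j : ∀ {a b₁ b₂ c : C} (g : T2 b₁ b₂ c) (p : a ⟶ b₂),
    bu₂ g (j1 p) = T2.act (𝟙 b₁) p (𝟙 c) g
  bu₁_j : ∀ {a b₁ b₂ c : C} (g : T2 b₁ b₂ c) (p : a ⟶ b₁),
    bu₁ g (j1 p) = j2 (T2.act p (𝟙 b₂) (𝟙 c) g)
  ub_j : ∀ {a₁ a₂ b c : C} (p : b ⟶ c) (g : T2 a₁ a₂ b),
    ub (j1 p) g = j2 (T2.act (𝟙 a₁) (𝟙 a₂) p g)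
  un_j : ∀ {b c : C} (p : b ⟶ c) (w : L0 b), un (j1 p) w = L0.act p w
  -- naturality and dinaturality of the substitutions
  bb₁_nat : ∀ {a₁ a₁' a₂ a₂' b₁ b₂ b₂' c c' : C} (p₁ : a₁' ⟶ a₁) (p₂ : a₂' ⟶ a₂)
    (r₂ : b₂' ⟶ b₂) (q : c ⟶ c') (f : T2 b₁ b₂ c) (g : T2 a₁ a₂ b₁),
    bb₁ (T2.act (𝟙 b₁) r₂ q f) (T2.act p₁ p₂ (𝟙 b₁) g) = T3.act p₁ p₂ r₂ q (bb₁ f g)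
  bb₁_dinat : ∀ {a₁ a₂ b₁ b₁' b₂ c : C} (s : b₁' ⟶ b₁) (f : T2 b₁ b₂ c) (g : T2 a₁ a₂ b₁'),
    bb₁ (T2.act s (𝟙 b₂) (𝟙 c) f) g = bb₁ f (T2.act (𝟙 a₁) (𝟙 a₂) s g)
  bb₂_nat : ∀ {a₁ a₁' a₂ a₂' b₁ b₁' b₂ c c' : C} (p₁ : a₁' ⟶ a₁) (p₂ : a₂' ⟶ a₂)
    (r₁ : b₁' ⟶ b₁) (q : c ⟶ c') (f : T2 b₁ b₂ c) (g : T2 a₁ a₂ b₂),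
    bb₂ (T2.act r₁ (𝟙 b₂) q f) (T2.act p₁ p₂ (𝟙 b₂) g) = T3.act r₁ p₁ p₂ q (bb₂ f g)
  bb₂_dinat : ∀ {a₁ a₂ b₁ b₂ b₂' c : C} (s : b₂' ⟶ b₂) (f : T2 b₁ b₂ c) (g : T2 a₁ a₂ b₂'),
    bb₂ (T2.act (𝟙 b₁) s (𝟙 c) f) g = bb₂ f (T2.act (𝟙 a₁) (𝟙 a₂) s g)
  tb₁_nat : ∀ {a₁ a₁' a₂ a₂' b₁ b₂ b₂' b₃ b₃' c c' : C} (p₁ : a₁' ⟶ a₁) (p₂ : a₂' ⟶ a₂)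
    (r₂ : b₂' ⟶ b₂) (r₃ : b₃' ⟶ b₃) (q : c ⟶ c') (f : T3 b₁ b₂ b₃ c) (g : T2 a₁ a₂ b₁),
    tb₁ (T3.act (𝟙 b₁) r₂ r₃ q f) (T2.act p₁ p₂ (𝟙 b₁) g) = T4.act p₁ p₂ r₂ r₃ q (tb₁ f g)
  tb₁_dinat : ∀ {a₁ a₂ b₁ b₁' b₂ b₃ c : C} (s : b₁' ⟶ b₁) (f : T3 b₁ b₂ b₃ c)
    (g : T2 a₁ a₂ b₁'),
    tb₁ (T3.act s (𝟙 b₂) (𝟙 b₃) (𝟙 c) f) g = tb₁ f (T2.act (𝟙 a₁) (𝟙 a₂) s g)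
  tb₂_nat : ∀ {a₁ a₁' a₂ a₂' b₁ b₁' b₂ b₃ b₃' c c' : C} (p₁ : a₁' ⟶ a₁) (p₂ : a₂' ⟶ a₂)
    (r₁ : b₁' ⟶ b₁) (r₃ : b₃' ⟶ b₃) (q : c ⟶ c') (f : T3 b₁ b₂ b₃ c) (g : T2 a₁ a₂ b₂),
    tb₂ (T3.act r₁ (𝟙 b₂) r₃ q f) (T2.act p₁ p₂ (𝟙 b₂) g) = T4.act r₁ p₁ p₂ r₃ q (tb₂ f g)
  tb₂_dinat : ∀ {a₁ a₂ b₁ b₂ b₂' b₃ c : C} (s : b₂' ⟶ b₂) (f : T3 b₁ b₂ b₃ c)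
    (g : T2 a₁ a₂ b₂'),
    tb₂ (T3.act (𝟙 b₁) s (𝟙 b₃) (𝟙 c) f) g = tb₂ f (T2.act (𝟙 a₁) (𝟙 a₂) s g)
  tb₃_nat : ∀ {a₁ a₁' a₂ a₂' b₁ b₁' b₂ b₂' b₃ c c' : C} (p₁ : a₁' ⟶ a₁) (p₂ : a₂' ⟶ a₂)
    (r₁ : b₁' ⟶ b₁) (r₂ : b₂' ⟶ b₂) (q : c ⟶ c') (f : T3 b₁ b₂ b₃ c) (g : T2 a₁ a₂ b₃),
    tb₃ (T3.act r₁ r₂ (𝟙 b₃) q f) (T2.act p₁ p₂ (𝟙 b₃) g) = T4.act r₁ r₂ p₁ p₂ q (tb₃ f g)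
  tb₃_dinat : ∀ {a₁ a₂ b₁ b₂ b₃ b₃' c : C} (s : b₃' ⟶ b₃) (f : T3 b₁ b₂ b₃ c)
    (g : T2 a₁ a₂ b₃'),
    tb₃ (T3.act (𝟙 b₁) (𝟙 b₂) s (𝟙 c) f) g = tb₃ f (T2.act (𝟙 a₁) (𝟙 a₂) s g)
  bt₁_nat : ∀ {a₁ a₁' a₂ a₂' a₃ a₃' b₁ b₂ b₂' c c' : C} (p₁ : a₁' ⟶ a₁) (p₂ : a₂' ⟶ a₂)
    (p₃ : a₃' ⟶ a₃) (r₂ : b₂' ⟶ b₂) (q : c ⟶ c') (f : T2 b₁ b₂ c) (g : T3 a₁ a₂ a₃ b₁),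
    bt₁ (T2.act (𝟙 b₁) r₂ q f) (T3.act p₁ p₂ p₃ (𝟙 b₁) g) = T4.act p₁ p₂ p₃ r₂ q (bt₁ f g)
  bt₁_dinat : ∀ {a₁ a₂ a₃ b₁ b₁' b₂ c : C} (s : b₁' ⟶ b₁) (f : T2 b₁ b₂ c)
    (g : T3 a₁ a₂ a₃ b₁'),
    bt₁ (T2.act s (𝟙 b₂) (𝟙 c) f) g = bt₁ f (T3.act (𝟙 a₁) (𝟙 a₂) (𝟙 a₃) s g)
  bt₂_nat : ∀ {a₁ a₁' a₂ a₂' a₃ a₃' b₁ b₁' b₂ c c' : C} (p₁ : a₁' ⟶ a₁) (p₂ : a₂' ⟶ a₂)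
    (p₃ : a₃' ⟶ a₃) (r₁ : b₁' ⟶ b₁) (q : c ⟶ c') (f : T2 b₁ b₂ c) (g : T3 a₁ a₂ a₃ b₂),
    bt₂ (T2.act r₁ (𝟙 b₂) q f) (T3.act p₁ p₂ p₃ (𝟙 b₂) g) = T4.act r₁ p₁ p₂ p₃ q (bt₂ f g)
  bt₂_dinat : ∀ {a₁ a₂ a₃ b₁ b₂ b₂' c : C} (s : b₂' ⟶ b₂) (f : T2 b₁ b₂ c)
    (g : T3 a₁ a₂ a₃ b₂'),
    bt₂ (T2.act (𝟙 b₁) s (𝟙 c) f) g = bt₂ f (T3.act (𝟙 a₁) (𝟙 a₂) (𝟙 a₃) s g)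
  bn₁_nat : ∀ {b₁ b₂ b₂' c c' : C} (r₂ : b₂' ⟶ b₂) (q : c ⟶ c') (f : T2 b₁ b₂ c) (w : L0 b₁),
    bn₁ (T2.act (𝟙 b₁) r₂ q f) w = L1.act r₂ q (bn₁ f w)
  bn₁_dinat : ∀ {b₁ b₁' b₂ c : C} (s : b₁' ⟶ b₁) (f : T2 b₁ b₂ c) (w : L0 b₁'),
    bn₁ (T2.act s (𝟙 b₂) (𝟙 c) f) w = bn₁ f (L0.act s w)
  bn₂_nat : ∀ {b₁ b₁' b₂ c c' : C} (r₁ : b₁' ⟶ b₁) (q : c ⟶ c') (f : T2 b₁ b₂ c) (w : L0 b₂),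
    bn₂ (T2.act r₁ (𝟙 b₂) q f) w = r₁ ≫ bn₂ f w ≫ q
  bn₂_dinat : ∀ {b₁ b₂ b₂' c : C} (s : b₂' ⟶ b₂) (f : T2 b₁ b₂ c) (w : L0 b₂'),
    bn₂ (T2.act (𝟙 b₁) s (𝟙 c) f) w = bn₂ f (L0.act s w)
  tn₁_nat : ∀ {b₁ b₂ b₂' b₃ b₃' c c' : C} (r₂ : b₂' ⟶ b₂) (r₃ : b₃' ⟶ b₃) (q : c ⟶ c')
    (f : T3 b₁ b₂ b₃ c) (w : L0 b₁),
    tn₁ (T3.act (𝟙 b₁) r₂ r₃ q f) w = L2.act r₂ r₃ q (tn₁ f w)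
  tn₁_dinat : ∀ {b₁ b₁' b₂ b₃ c : C} (s : b₁' ⟶ b₁) (f : T3 b₁ b₂ b₃ c) (w : L0 b₁'),
    tn₁ (T3.act s (𝟙 b₂) (𝟙 b₃) (𝟙 c) f) w = tn₁ f (L0.act s w)
  tn₂_nat : ∀ {b₁ b₁' b₂ b₃ b₃' c c' : C} (r₁ : b₁' ⟶ b₁) (r₃ : b₃' ⟶ b₃) (q : c ⟶ c')
    (f : T3 b₁ b₂ b₃ c) (w : L0 b₂),
    tn₂ (T3.act r₁ (𝟙 b₂) r₃ q f) w = T2.act r₁ r₃ q (tn₂ f w)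
  tn₂_dinat : ∀ {b₁ b₂ b₂' b₃ c : C} (s : b₂' ⟶ b₂) (f : T3 b₁ b₂ b₃ c) (w : L0 b₂'),
    tn₂ (T3.act (𝟙 b₁) s (𝟙 b₃) (𝟙 c) f) w = tn₂ f (L0.act s w)
  tn₃_nat : ∀ {b₁ b₁' b₂ b₂' b₃ c c' : C} (r₁ : b₁' ⟶ b₁) (r₂ : b₂' ⟶ b₂) (q : c ⟶ c')
    (f : T3 b₁ b₂ b₃ c) (w : L0 b₃),
    tn₃ (T3.act r₁ r₂ (𝟙 b₃) q f) w = T2.act r₁ r₂ q (tn₃ f w)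
  tn₃_dinat : ∀ {b₁ b₂ b₃ b₃' c : C} (s : b₃' ⟶ b₃) (f : T3 b₁ b₂ b₃ c) (w : L0 b₃'),
    tn₃ (T3.act (𝟙 b₁) (𝟙 b₂) s (𝟙 c) f) w = tn₃ f (L0.act s w)
  un_nat : ∀ {b c c' : C} (q : c ⟶ c') (f : L1 b c) (w : L0 b),
    un (L1.act (𝟙 b) q f) w = L0.act q (un f w)
  un_dinat : ∀ {b b' c : C} (s : b' ⟶ b) (f : L1 b c) (w : L0 b'),
    un (L1.act s (𝟙 c) f) w = un f (L0.act s w)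
  bu₁_nat : ∀ {a a' b₁ b₂ b₂' c c' : C} (p : a' ⟶ a) (r₂ : b₂' ⟶ b₂) (q : c ⟶ c')
    (f : T2 b₁ b₂ c) (g : L1 a b₁),
    bu₁ (T2.act (𝟙 b₁) r₂ q f) (L1.act p (𝟙 b₁) g) = L2.act p r₂ q (bu₁ f g)
  bu₁_dinat : ∀ {a b₁ b₁' b₂ c : C} (s : b₁' ⟶ b₁) (f : T2 b₁ b₂ c) (g : L1 a b₁'),
    bu₁ (T2.act s (𝟙 b₂) (𝟙 c) f) g = bu₁ f (L1.act (𝟙 a) s g)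
  bu₂_nat : ∀ {a a' b₁ b₁' b₂ c c' : C} (p : a' ⟶ a) (r₁ : b₁' ⟶ b₁) (q : c ⟶ c')
    (f : T2 b₁ b₂ c) (g : L1 a b₂),
    bu₂ (T2.act r₁ (𝟙 b₂) q f) (L1.act p (𝟙 b₂) g) = T2.act r₁ p q (bu₂ f g)
  bu₂_dinat : ∀ {a b₁ b₂ b₂' c : C} (s : b₂' ⟶ b₂) (f : T2 b₁ b₂ c) (g : L1 a b₂'),
    bu₂ (T2.act (𝟙 b₁) s (𝟙 c) f) g = bu₂ f (L1.act (𝟙 a) s g)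
  ub_nat : ∀ {a₁ a₁' a₂ a₂' b c c' : C} (p₁ : a₁' ⟶ a₁) (p₂ : a₂' ⟶ a₂) (q : c ⟶ c')
    (f : L1 b c) (g : T2 a₁ a₂ b),
    ub (L1.act (𝟙 b) q f) (T2.act p₁ p₂ (𝟙 b) g) = L2.act p₁ p₂ q (ub f g)
  ub_dinat : ∀ {a₁ a₂ b b' c : C} (s : b' ⟶ b) (f : L1 b c) (g : T2 a₁ a₂ b'),
    ub (L1.act s (𝟙 c) f) g = ub f (T2.act (𝟙 a₁) (𝟙 a₂) s g)
  -- `f ∘ᵢ (g ∘ⱼ h) = (f ∘ᵢ g) ∘ᵢ₊ⱼ₋₁ h`, all three tight binary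
  ass_a₁₁ : ∀ {a₁ a₂ b₁ b₂ c₁ c₂ d : C} (f : T2 c₁ c₂ d) (g : T2 b₁ b₂ c₁) (h : T2 a₁ a₂ b₁),
    bt₁ f (bb₁ g h) = tb₁ (bb₁ f g) h
  ass_a₁₂ : ∀ {a₁ a₂ b₁ b₂ c₁ c₂ d : C} (f : T2 c₁ c₂ d) (g : T2 b₁ b₂ c₁) (h : T2 a₁ a₂ b₂),
    bt₁ f (bb₂ g h) = tb₂ (bb₁ f g) h
  ass_a₂₁ : ∀ {a₁ a₂ b₁ b₂ c₁ c₂ d : C} (f : T2 c₁ c₂ d) (g : T2 b₁ b₂ c₂) (h : T2 a₁ a₂ b₁),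
    bt₂ f (bb₁ g h) = tb₂ (bb₂ f g) h
  ass_a₂₂ : ∀ {a₁ a₂ b₁ b₂ c₁ c₂ d : C} (f : T2 c₁ c₂ d) (g : T2 b₁ b₂ c₂) (h : T2 a₁ a₂ b₂),
    bt₂ f (bb₂ g h) = tb₃ (bb₂ f g) h
  -- the same equation with `f`, `g` tight binary and `h` nullary
  ass_b₁₁ : ∀ {b₁ b₂ c₁ c₂ d : C} (f : T2 c₁ c₂ d) (g : T2 b₁ b₂ c₁) (h : L0 b₁),
    bu₁ f (bn₁ g h) = tn₁ (bb₁ f g) h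
  ass_b₁₂ : ∀ {b₁ b₂ c₁ c₂ d : C} (f : T2 c₁ c₂ d) (g : T2 b₁ b₂ c₁) (h : L0 b₂),
    T2.act (bn₂ g h) (𝟙 c₂) (𝟙 d) f = tn₂ (bb₁ f g) h
  ass_b₂₁ : ∀ {b₁ b₂ c₁ c₂ d : C} (f : T2 c₁ c₂ d) (g : T2 b₁ b₂ c₂) (h : L0 b₁),
    bu₂ f (bn₁ g h) = tn₂ (bb₂ f g) h
  ass_b₂₂ : ∀ {b₁ b₂ c₁ c₂ d : C} (f : T2 c₁ c₂ d) (g : T2 b₁ b₂ c₂) (h : L0 b₂),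
    T2.act (𝟙 c₁) (bn₂ g h) (𝟙 d) f = tn₃ (bb₂ f g) h
  -- `(f ∘₁ g) ∘ₙ₊₁ h = (f ∘₂ h) ∘₁ g` with `f` tight binary, and `(g, h)` respectively
  -- (binary, binary), (binary, nullary), (nullary, binary), (nullary, nullary)
  comm_a : ∀ {a₁ a₂ b₁ b₂ c₁ c₂ d : C} (f : T2 c₁ c₂ d) (g : T2 a₁ a₂ c₁) (h : T2 b₁ b₂ c₂),
    tb₃ (bb₁ f g) h = tb₁ (bb₂ f h) g
  comm_b : ∀ {a₁ a₂ c₁ c₂ d : C} (f : T2 c₁ c₂ d) (g : T2 a₁ a₂ c₁) (h : L0 c₂),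
    tn₃ (bb₁ f g) h = T2.act (𝟙 a₁) (𝟙 a₂) (bn₂ f h) g
  comm_c : ∀ {b₁ b₂ c₁ c₂ d : C} (f : T2 c₁ c₂ d) (g : L0 c₁) (h : T2 b₁ b₂ c₂),
    ub (bn₁ f g) h = tn₁ (bb₂ f h) g
  comm_d : ∀ {c₁ c₂ d : C} (f : T2 c₁ c₂ d) (g : L0 c₁) (h : L0 c₂),
    un (bn₁ f g) h = L0.act (bn₂ f h) g

/-- A morphism of short skew multicategories: a functor with natural families `T2, T3, T4` on tight
and `L0, L1, L2` on loose multimaps which commute with all substitutions and with the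
comparisons. -/
@[ext]
structure ShortSkewMulti.Hom {C D : Type u} [Category.{v} C] [Category.{v} D]
    (M : ShortSkewMulti C) (N : ShortSkewMulti D) where
  F : C ⥤ D
  T2 : ∀ {a b c : C}, M.T2 a b c → N.T2 (F.obj a) (F.obj b) (F.obj c)
  T3 : ∀ {a₁ a₂ a₃ c : C}, M.T3 a₁ a₂ a₃ c →
    N.T3 (F.obj a₁) (F.obj a₂) (F.obj a₃) (F.obj c)
  T4 : ∀ {a₁ a₂ a₃ a₄ c : C}, M.T4 a₁ a₂ a₃ a₄ c →
    N.T4 (F.obj a₁) (F.obj a₂) (F.obj a₃) (F.obj a₄) (F.obj c)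
  L0 : ∀ {c : C}, M.L0 c → N.L0 (F.obj c)
  L1 : ∀ {a c : C}, M.L1 a c → N.L1 (F.obj a) (F.obj c)
  L2 : ∀ {a b c : C}, M.L2 a b c → N.L2 (F.obj a) (F.obj b) (F.obj c)
  T2_nat : ∀ {a₁ a₁' a₂ a₂' c c' : C} (p₁ : a₁' ⟶ a₁) (p₂ : a₂' ⟶ a₂) (q : c ⟶ c')
    (f : M.T2 a₁ a₂ c),
    T2 (M.T2.act p₁ p₂ q f) = N.T2.act (F.map p₁) (F.map p₂) (F.map q) (T2 f)
  T3_nat : ∀ {a₁ a₁' a₂ a₂' a₃ a₃' c c' : C} (p₁ : a₁' ⟶ a₁) (p₂ : a₂' ⟶ a₂) (p₃ : a₃' ⟶ a₃)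
    (q : c ⟶ c') (f : M.T3 a₁ a₂ a₃ c),
    T3 (M.T3.act p₁ p₂ p₃ q f) =
      N.T3.act (F.map p₁) (F.map p₂) (F.map p₃) (F.map q) (T3 f)
  T4_nat : ∀ {a₁ a₁' a₂ a₂' a₃ a₃' a₄ a₄' c c' : C} (p₁ : a₁' ⟶ a₁) (p₂ : a₂' ⟶ a₂)
    (p₃ : a₃' ⟶ a₃) (p₄ : a₄' ⟶ a₄) (q : c ⟶ c') (f : M.T4 a₁ a₂ a₃ a₄ c),
    T4 (M.T4.act p₁ p₂ p₃ p₄ q f) =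
      N.T4.act (F.map p₁) (F.map p₂) (F.map p₃) (F.map p₄) (F.map q) (T4 f)
  L0_nat : ∀ {c c' : C} (q : c ⟶ c') (f : M.L0 c), L0 (M.L0.act q f) = N.L0.act (F.map q) (L0 f)
  L1_nat : ∀ {a a' c c' : C} (p : a' ⟶ a) (q : c ⟶ c') (f : M.L1 a c),
    L1 (M.L1.act p q f) = N.L1.act (F.map p) (F.map q) (L1 f)
  L2_nat : ∀ {a₁ a₁' a₂ a₂' c c' : C} (p₁ : a₁' ⟶ a₁) (p₂ : a₂' ⟶ a₂) (q : c ⟶ c')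
    (f : M.L2 a₁ a₂ c),
    L2 (M.L2.act p₁ p₂ q f) = N.L2.act (F.map p₁) (F.map p₂) (F.map q) (L2 f)
  map_j1 : ∀ {a c : C} (f : a ⟶ c), L1 (M.j1 f) = N.j1 (F.map f)
  map_j2 : ∀ {a b c : C} (f : M.T2 a b c), L2 (M.j2 f) = N.j2 (T2 f)
  map_bb₁ : ∀ {a₁ a₂ b₁ b₂ c : C} (f : M.T2 b₁ b₂ c) (g : M.T2 a₁ a₂ b₁),
    T3 (M.bb₁ f g) = N.bb₁ (T2 f) (T2 g)
  map_bb₂ : ∀ {a₁ a₂ b₁ b₂ c : C} (f : M.T2 b₁ b₂ c) (g : M.T2 a₁ a₂ b₂),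
    T3 (M.bb₂ f g) = N.bb₂ (T2 f) (T2 g)
  map_tb₁ : ∀ {a₁ a₂ b₁ b₂ b₃ c : C} (f : M.T3 b₁ b₂ b₃ c) (g : M.T2 a₁ a₂ b₁),
    T4 (M.tb₁ f g) = N.tb₁ (T3 f) (T2 g)
  map_tb₂ : ∀ {a₁ a₂ b₁ b₂ b₃ c : C} (f : M.T3 b₁ b₂ b₃ c) (g : M.T2 a₁ a₂ b₂),
    T4 (M.tb₂ f g) = N.tb₂ (T3 f) (T2 g)
  map_tb₃ : ∀ {a₁ a₂ b₁ b₂ b₃ c : C} (f : M.T3 b₁ b₂ b₃ c) (g : M.T2 a₁ a₂ b₃),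
    T4 (M.tb₃ f g) = N.tb₃ (T3 f) (T2 g)
  map_bt₁ : ∀ {a₁ a₂ a₃ b₁ b₂ c : C} (f : M.T2 b₁ b₂ c) (g : M.T3 a₁ a₂ a₃ b₁),
    T4 (M.bt₁ f g) = N.bt₁ (T2 f) (T3 g)
  map_bt₂ : ∀ {a₁ a₂ a₃ b₁ b₂ c : C} (f : M.T2 b₁ b₂ c) (g : M.T3 a₁ a₂ a₃ b₂),
    T4 (M.bt₂ f g) = N.bt₂ (T2 f) (T3 g)
  map_bn₁ : ∀ {b₁ b₂ c : C} (f : M.T2 b₁ b₂ c) (w : M.L0 b₁),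
    L1 (M.bn₁ f w) = N.bn₁ (T2 f) (L0 w)
  map_bn₂ : ∀ {b₁ b₂ c : C} (f : M.T2 b₁ b₂ c) (w : M.L0 b₂),
    F.map (M.bn₂ f w) = N.bn₂ (T2 f) (L0 w)
  map_tn₁ : ∀ {b₁ b₂ b₃ c : C} (f : M.T3 b₁ b₂ b₃ c) (w : M.L0 b₁),
    L2 (M.tn₁ f w) = N.tn₁ (T3 f) (L0 w)
  map_tn₂ : ∀ {b₁ b₂ b₃ c : C} (f : M.T3 b₁ b₂ b₃ c) (w : M.L0 b₂),
    T2 (M.tn₂ f w) = N.tn₂ (T3 f) (L0 w)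
  map_tn₃ : ∀ {b₁ b₂ b₃ c : C} (f : M.T3 b₁ b₂ b₃ c) (w : M.L0 b₃),
    T2 (M.tn₃ f w) = N.tn₃ (T3 f) (L0 w)
  map_un : ∀ {b c : C} (f : M.L1 b c) (w : M.L0 b), L0 (M.un f w) = N.un (L1 f) (L0 w)
  map_bu₁ : ∀ {a b₁ b₂ c : C} (f : M.T2 b₁ b₂ c) (g : M.L1 a b₁),
    L2 (M.bu₁ f g) = N.bu₁ (T2 f) (L1 g)
  map_bu₂ : ∀ {a b₁ b₂ c : C} (f : M.T2 b₁ b₂ c) (g : M.L1 a b₂),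
    T2 (M.bu₂ f g) = N.bu₂ (T2 f) (L1 g)
  map_ub : ∀ {a₁ a₂ b c : C} (f : M.L1 b c) (g : M.T2 a₁ a₂ b),
    L2 (M.ub f g) = N.ub (L1 f) (T2 g)

namespace ShortSkewMulti

/-- The identity morphism. -/
def Hom.id {C : Type u} [Category.{v} C] (M : ShortSkewMulti C) : Hom M M where
  F := 𝟭 C
  T2 f := f
  T3 f := f
  T4 f := f
  L0 f := f
  L1 f := f
  L2 f := f
  T2_nat _ _ _ _ := rfl
  T3_nat _ _ _ _ _ := rfl
  T4_nat _ _ _ _ _ _ := rfl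
  L0_nat _ _ := rfl
  L1_nat _ _ _ := rfl
  L2_nat _ _ _ _ := rfl
  map_j1 _ := rfl
  map_j2 _ := rfl
  map_bb₁ _ _ := rfl
  map_bb₂ _ _ := rfl
  map_tb₁ _ _ := rfl
  map_tb₂ _ _ := rfl
  map_tb₃ _ _ := rfl
  map_bt₁ _ _ := rfl
  map_bt₂ _ _ := rfl
  map_bn₁ _ _ := rfl
  map_bn₂ _ _ := rfl
  map_tn₁ _ _ := rfl
  map_tn₂ _ _ := rfl
  map_tn₃ _ _ := rfl
  map_un _ _ := rfl
  map_bu₁ _ _ := rfl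
  map_bu₂ _ _ := rfl
  map_ub _ _ := rfl

/-- Composition of morphisms. -/
def Hom.comp {C D E : Type u} [Category.{v} C] [Category.{v} D] [Category.{v} E]
    {M : ShortSkewMulti C} {N : ShortSkewMulti D} {P : ShortSkewMulti E}
    (G : Hom M N) (H : Hom N P) : Hom M P where
  F := G.F ⋙ H.F
  T2 f := H.T2 (G.T2 f)
  T3 f := H.T3 (G.T3 f)
  T4 f := H.T4 (G.T4 f)
  L0 f := H.L0 (G.L0 f)
  L1 f := H.L1 (G.L1 f)
  L2 f := H.L2 (G.L2 f)
  T2_nat _ _ _ _ := by simp [G.T2_nat, H.T2_nat]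
  T3_nat _ _ _ _ _ := by simp [G.T3_nat, H.T3_nat]
  T4_nat _ _ _ _ _ _ := by simp [G.T4_nat, H.T4_nat]
  L0_nat _ _ := by simp [G.L0_nat, H.L0_nat]
  L1_nat _ _ _ := by simp [G.L1_nat, H.L1_nat]
  L2_nat _ _ _ _ := by simp [G.L2_nat, H.L2_nat]
  map_j1 _ := by simp [G.map_j1, H.map_j1]
  map_j2 _ := by simp [G.map_j2, H.map_j2]
  map_bb₁ _ _ := by simp [G.map_bb₁, H.map_bb₁]
  map_bb₂ _ _ := by simp [G.map_bb₂, H.map_bb₂]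
  map_tb₁ _ _ := by simp [G.map_tb₁, H.map_tb₁]
  map_tb₂ _ _ := by simp [G.map_tb₂, H.map_tb₂]
  map_tb₃ _ _ := by simp [G.map_tb₃, H.map_tb₃]
  map_bt₁ _ _ := by simp [G.map_bt₁, H.map_bt₁]
  map_bt₂ _ _ := by simp [G.map_bt₂, H.map_bt₂]
  map_bn₁ _ _ := by simp [G.map_bn₁, H.map_bn₁]
  map_bn₂ _ _ := by simp [G.map_bn₂, H.map_bn₂]
  map_tn₁ _ _ := by simp [G.map_tn₁, H.map_tn₁]
  map_tn₂ _ _ := by simp [G.map_tn₂, H.map_tn₂]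
  map_tn₃ _ _ := by simp [G.map_tn₃, H.map_tn₃]
  map_un _ _ := by simp [G.map_un, H.map_un]
  map_bu₁ _ _ := by simp [G.map_bu₁, H.map_bu₁]
  map_bu₂ _ _ := by simp [G.map_bu₂, H.map_bu₂]
  map_ub _ _ := by simp [G.map_ub, H.map_ub]

end ShortSkewMulti

/-- A short skew multicategory: a category with the structure above. -/
structure FSMulti : Type (max (u + 1) (v + 1)) where
  C : Type u
  [cat : Category.{v} C]
  M : ShortSkewMulti C

attribute [instance] FSMulti.cat

/-- The category of short skew multicategories. -/
instance : Category FSMulti.{v, u} where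
  Hom X Y := ShortSkewMulti.Hom X.M Y.M
  id X := ShortSkewMulti.Hom.id X.M
  comp F G := F.comp G
  id_comp _ := rfl
  comp_id _ := rfl
  assoc _ _ _ := rfl

/-! ### Left representability -/

namespace ShortSkewMulti

variable {C : Type u} [Category.{v} C] (M : ShortSkewMulti C)

/-- `θ` is a left universal tight binary map classifier for `a` and `b`. -/
structure IsLeftUniversalBinary {a b ab : C} (θ : M.T2 a b ab) : Prop where
  bij₁ : ∀ d : C, Function.Bijective (fun f : ab ⟶ d => M.T2.act (𝟙 a) (𝟙 b) f θ)
  bij₂ : ∀ x d : C, Function.Bijective (fun f : M.T2 ab x d => M.bb₁ f θ)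
  bij₃ : ∀ x y d : C, Function.Bijective (fun f : M.T3 ab x y d => M.tb₁ f θ)

/-- `w` is a left universal nullary map classifier. -/
structure IsLeftUniversalNullary {i : C} (w : M.L0 i) : Prop where
  bij₀ : ∀ d : C, Function.Bijective (fun f : i ⟶ d => M.L0.act f w)
  bij₁ : ∀ x d : C, Function.Bijective (fun f : M.T2 i x d => M.bn₁ f w)
  bij₂ : ∀ x y d : C, Function.Bijective (fun f : M.T3 i x y d => M.tn₁ f w)

/-- `M` admits left universal nullary and tight binary map classifiers. -/
def IsLeftRepresentable : Prop :=
  (∃ (i : C) (w : M.L0 i), M.IsLeftUniversalNullary w) ∧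
    ∀ a b : C, ∃ (ab : C) (θ : M.T2 a b ab), M.IsLeftUniversalBinary θ

/-- A choice of left universal nullary and tight binary map classifiers. -/
structure Classifiers where
  i : C
  u : M.L0 i
  u_univ : M.IsLeftUniversalNullary u
  m : C → C → C
  θ : ∀ a b : C, M.T2 a b (m a b)
  θ_univ : ∀ a b : C, M.IsLeftUniversalBinary (θ a b)

theorem IsLeftRepresentable.nonempty_classifiers {M : ShortSkewMulti C}
    (h : M.IsLeftRepresentable) : Nonempty M.Classifiers := by
  obtain ⟨⟨i, w, hw⟩, h⟩ := h
  choose m θ hθ using h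
  exact ⟨⟨i, w, hw, m, θ, hθ⟩⟩

/-! ### Short braidings -/

/-- A short braiding: natural isomorphisms `β32 = β³₂`, `β42 = β⁴₂`, `β43 = β⁴₃`
satisfying six axioms. -/
structure ShortBraiding where
  β32 : ∀ {a₁ a₂ a₃ c : C}, M.T3 a₁ a₂ a₃ c ≃ M.T3 a₁ a₃ a₂ c
  β42 : ∀ {a₁ a₂ a₃ a₄ c : C}, M.T4 a₁ a₂ a₃ a₄ c ≃ M.T4 a₁ a₃ a₂ a₄ c
  β43 : ∀ {a₁ a₂ a₃ a₄ c : C}, M.T4 a₁ a₂ a₃ a₄ c ≃ M.T4 a₁ a₂ a₄ a₃ c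
  β32_nat : ∀ {a₁ a₁' a₂ a₂' a₃ a₃' c c' : C} (p₁ : a₁' ⟶ a₁) (p₂ : a₂' ⟶ a₂) (p₃ : a₃' ⟶ a₃)
    (q : c ⟶ c') (f : M.T3 a₁ a₂ a₃ c),
    β32 (M.T3.act p₁ p₂ p₃ q f) = M.T3.act p₁ p₃ p₂ q (β32 f)
  β42_nat : ∀ {a₁ a₁' a₂ a₂' a₃ a₃' a₄ a₄' c c' : C} (p₁ : a₁' ⟶ a₁) (p₂ : a₂' ⟶ a₂)
    (p₃ : a₃' ⟶ a₃) (p₄ : a₄' ⟶ a₄) (q : c ⟶ c') (f : M.T4 a₁ a₂ a₃ a₄ c),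
    β42 (M.T4.act p₁ p₂ p₃ p₄ q f) = M.T4.act p₁ p₃ p₂ p₄ q (β42 f)
  β43_nat : ∀ {a₁ a₁' a₂ a₂' a₃ a₃' a₄ a₄' c c' : C} (p₁ : a₁' ⟶ a₁) (p₂ : a₂' ⟶ a₂)
    (p₃ : a₃' ⟶ a₃) (p₄ : a₄' ⟶ a₄) (q : c ⟶ c') (f : M.T4 a₁ a₂ a₃ a₄ c),
    β43 (M.T4.act p₁ p₂ p₃ p₄ q f) = M.T4.act p₁ p₂ p₄ p₃ q (β43 f)
  braid : ∀ {a₁ a₂ a₃ a₄ c : C} (h : M.T4 a₁ a₂ a₃ a₄ c),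
    β42 (β43 (β42 h)) = β43 (β42 (β43 h))
  bt₁_β : ∀ {a₁ a₂ a₃ b₁ b₂ c : C} (g : M.T2 b₁ b₂ c) (f : M.T3 a₁ a₂ a₃ b₁),
    M.bt₁ g (β32 f) = β42 (M.bt₁ g f)
  bt₂_β : ∀ {a₁ a₂ a₃ b₁ b₂ c : C} (g : M.T2 b₁ b₂ c) (f : M.T3 a₁ a₂ a₃ b₂),
    M.bt₂ g (β32 f) = β43 (M.bt₂ g f)
  tb₁_β : ∀ {a₁ a₂ b₁ b₂ b₃ c : C} (g : M.T3 b₁ b₂ b₃ c) (f : M.T2 a₁ a₂ b₁),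
    β43 (M.tb₁ g f) = M.tb₁ (β32 g) f
  tb₂_β : ∀ {a₁ a₂ b₁ b₂ b₃ c : C} (g : M.T3 b₁ b₂ b₃ c) (f : M.T2 a₁ a₂ b₂),
    β42 (β43 (M.tb₂ g f)) = M.tb₃ (β32 g) f
  tb₃_β : ∀ {a₁ a₂ b₁ b₂ b₃ c : C} (g : M.T3 b₁ b₂ b₃ c) (f : M.T2 a₁ a₂ b₃),
    β43 (β42 (M.tb₃ g f)) = M.tb₂ (β32 g) f

variable {M}

/-- A short braiding is a short symmetry if `β³₂ β³₂ = 1`. -/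
def ShortBraiding.IsSymmetry (B : M.ShortBraiding) : Prop :=
  ∀ {a₁ a₂ a₃ c : C} (f : M.T3 a₁ a₂ a₃ c), B.β32 (B.β32 f) = f

/-- A morphism of short skew multicategories is braided if it respects `β³₂, β⁴₂, β⁴₃`. -/
structure Hom.IsBraided {D : Type u} [Category.{v} D] {N : ShortSkewMulti D}
    (G : Hom M N) (B : M.ShortBraiding) (B' : N.ShortBraiding) : Prop where
  β32 : ∀ {a₁ a₂ a₃ c : C} (f : M.T3 a₁ a₂ a₃ c), G.T3 (B.β32 f) = B'.β32 (G.T3 f)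
  β42 : ∀ {a₁ a₂ a₃ a₄ c : C} (f : M.T4 a₁ a₂ a₃ a₄ c), G.T4 (B.β42 f) = B'.β42 (G.T4 f)
  β43 : ∀ {a₁ a₂ a₃ a₄ c : C} (f : M.T4 a₁ a₂ a₃ a₄ c), G.T4 (B.β43 f) = B'.β43 (G.T4 f)

end ShortSkewMulti

/-- A braided short skew multicategory. -/
structure BrdFSMulti : Type (max (u + 1) (v + 1)) extends FSMulti.{v, u} where
  B : M.ShortBraiding

/-- A braided morphism of braided short skew multicategories. -/
@[ext]
structure BrdFSMulti.Hom (X Y : BrdFSMulti.{v, u}) where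
  hom : X.toFSMulti ⟶ Y.toFSMulti
  isBraided : ShortSkewMulti.Hom.IsBraided hom X.B Y.B

/-- The category of braided short skew multicategories. -/
instance : Category BrdFSMulti.{v, u} where
  Hom X Y := BrdFSMulti.Hom X Y
  id X := ⟨𝟙 X.toFSMulti, ⟨fun _ => rfl, fun _ => rfl, fun _ => rfl⟩⟩
  comp G H := ⟨G.hom ≫ H.hom,
    ⟨fun f => (congrArg _ (G.isBraided.β32 f)).trans (H.isBraided.β32 _),
     fun f => (congrArg _ (G.isBraided.β42 f)).trans (H.isBraided.β42 _),
     fun f => (congrArg _ (G.isBraided.β43 f)).trans (H.isBraided.β43 _)⟩⟩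
  id_comp _ := rfl
  comp_id _ := rfl
  assoc _ _ _ := rfl

/-- The category of left representable short skew multicategories, a full subcategory. -/
abbrev FSMultiLR : Type (max (u + 1) (v + 1)) :=
  ObjectProperty.FullSubcategory (C := FSMulti.{v, u}) fun X => X.M.IsLeftRepresentable

/-- The category of left representable braided short skew multicategories, a full subcategory. -/
abbrev BrdFSMultiLR : Type (max (u + 1) (v + 1)) :=
  ObjectProperty.FullSubcategory (C := BrdFSMulti.{v, u}) fun X => X.M.IsLeftRepresentable

/-- The category of left representable symmetric short skew multicategories: the full subcategory of
the braided ones whose braiding is a symmetry. -/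
abbrev SymFSMultiLR : Type (max (u + 1) (v + 1)) :=
  ObjectProperty.FullSubcategory (C := BrdFSMulti.{v, u}) fun X =>
    X.B.IsSymmetry ∧ X.M.IsLeftRepresentable

/-! ### Skew monoidal categories -/

/-- A (left) skew monoidal structure on a category. -/
structure SkewMonoidal (C : Type u) [Category.{v} C] where
  m : C → C → C
  mMap : ∀ {a a' b b' : C}, (a ⟶ a') → (b ⟶ b') → (m a b ⟶ m a' b')
  mMap_id : ∀ a b : C, mMap (𝟙 a) (𝟙 b) = 𝟙 (m a b)
  mMap_comp : ∀ {a a' a'' b b' b'' : C} (f : a ⟶ a') (f' : a' ⟶ a'') (g : b ⟶ b') (g' : b' ⟶ b''),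
    mMap (f ≫ f') (g ≫ g') = mMap f g ≫ mMap f' g'
  i : C
  α : ∀ a b c : C, m (m a b) c ⟶ m a (m b c)
  l : ∀ a : C, m i a ⟶ a
  ρ : ∀ a : C, a ⟶ m a i
  α_nat : ∀ {a a' b b' c c' : C} (f : a ⟶ a') (g : b ⟶ b') (h : c ⟶ c'),
    mMap (mMap f g) h ≫ α a' b' c' = α a b c ≫ mMap f (mMap g h)
  l_nat : ∀ {a a' : C} (f : a ⟶ a'), mMap (𝟙 i) f ≫ l a' = l a ≫ f
  ρ_nat : ∀ {a a' : C} (f : a ⟶ a'), f ≫ ρ a' = ρ a ≫ mMap f (𝟙 i)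
  pentagon : ∀ a b c d : C,
    α (m a b) c d ≫ α a b (m c d) =
      mMap (α a b c) (𝟙 d) ≫ α a (m b c) d ≫ mMap (𝟙 a) (α b c d)
  ax_iab : ∀ a b : C, α i a b ≫ l (m a b) = mMap (l a) (𝟙 b)
  ax_abi : ∀ a b : C, ρ (m a b) ≫ α a b i = mMap (𝟙 a) (ρ b)
  ax_aib : ∀ a b : C, mMap (ρ a) (𝟙 b) ≫ α a i b ≫ mMap (𝟙 a) (l b) = 𝟙 (m a b)
  ax_ii : ρ i ≫ l i = 𝟙 i

namespace SkewMonoidal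

/-- A lax monoidal functor `(F, f0, f2)` between skew monoidal categories. -/
@[ext]
structure Lax {C D : Type u} [Category.{v} C] [Category.{v} D]
    (S : SkewMonoidal C) (T : SkewMonoidal D) where
  F : C ⥤ D
  f0 : T.i ⟶ F.obj S.i
  f2 : ∀ a b : C, T.m (F.obj a) (F.obj b) ⟶ F.obj (S.m a b)
  f2_nat : ∀ {a a' b b' : C} (p : a ⟶ a') (q : b ⟶ b'),
    T.mMap (F.map p) (F.map q) ≫ f2 a' b' = f2 a b ≫ F.map (S.mMap p q)
  ax_α : ∀ a b c : C,
    T.mMap (f2 a b) (𝟙 (F.obj c)) ≫ f2 (S.m a b) c ≫ F.map (S.α a b c) =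
      T.α (F.obj a) (F.obj b) (F.obj c) ≫ T.mMap (𝟙 (F.obj a)) (f2 b c) ≫ f2 a (S.m b c)
  ax_l : ∀ a : C,
    T.mMap f0 (𝟙 (F.obj a)) ≫ f2 S.i a ≫ F.map (S.l a) = T.l (F.obj a)
  ax_ρ : ∀ a : C,
    T.ρ (F.obj a) ≫ T.mMap (𝟙 (F.obj a)) f0 ≫ f2 a S.i = F.map (S.ρ a)

theorem mMap_comp_id {C : Type u} [Category.{v} C] (S : SkewMonoidal C) {a a' a'' : C}
    (f : a ⟶ a') (f' : a' ⟶ a'') (b : C) :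
    S.mMap (f ≫ f') (𝟙 b) = S.mMap f (𝟙 b) ≫ S.mMap f' (𝟙 b) := by
  rw [← S.mMap_comp, Category.id_comp]

theorem mMap_id_comp {C : Type u} [Category.{v} C] (S : SkewMonoidal C) (a : C) {b b' b'' : C}
    (g : b ⟶ b') (g' : b' ⟶ b'') :
    S.mMap (𝟙 a) (g ≫ g') = S.mMap (𝟙 a) g ≫ S.mMap (𝟙 a) g' := by
  rw [← S.mMap_comp, Category.id_comp]

theorem Lax.f2_nat_left {C D : Type u} [Category.{v} C] [Category.{v} D]
    {S : SkewMonoidal C} {T : SkewMonoidal D} (G : Lax S T) {a a' : C} (p : a ⟶ a') (b : C)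
    {d : D} (k : G.F.obj (S.m a' b) ⟶ d) :
    T.mMap (G.F.map p) (𝟙 (G.F.obj b)) ≫ G.f2 a' b ≫ k =
      G.f2 a b ≫ G.F.map (S.mMap p (𝟙 b)) ≫ k := by
  have h := G.f2_nat p (𝟙 b)
  rw [G.F.map_id] at h
  rw [← Category.assoc, h, Category.assoc]

theorem Lax.f2_nat_right {C D : Type u} [Category.{v} C] [Category.{v} D]
    {S : SkewMonoidal C} {T : SkewMonoidal D} (G : Lax S T) (a : C) {b b' : C} (q : b ⟶ b')
    {d : D} (k : G.F.obj (S.m a b') ⟶ d) :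
    T.mMap (𝟙 (G.F.obj a)) (G.F.map q) ≫ G.f2 a b' ≫ k =
      G.f2 a b ≫ G.F.map (S.mMap (𝟙 a) q) ≫ k := by
  have h := G.f2_nat (𝟙 a) q
  rw [G.F.map_id] at h
  rw [← Category.assoc, h, Category.assoc]

/-- The identity lax monoidal functor. -/
def Lax.id {C : Type u} [Category.{v} C] (S : SkewMonoidal C) : Lax S S where
  F := 𝟭 C
  f0 := 𝟙 _
  f2 _ _ := 𝟙 _
  f2_nat _ _ := by simp
  ax_α _ _ _ := by simp [S.mMap_id]
  ax_l _ := by simp [S.mMap_id]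
  ax_ρ _ := by simp [S.mMap_id]

/-- Composition of lax monoidal functors. -/
def Lax.comp {C D E : Type u} [Category.{v} C] [Category.{v} D] [Category.{v} E]
    {S : SkewMonoidal C} {T : SkewMonoidal D} {R : SkewMonoidal E}
    (G : Lax S T) (H : Lax T R) : Lax S R where
  F := G.F ⋙ H.F
  f0 := H.f0 ≫ H.F.map G.f0
  f2 a b := H.f2 (G.F.obj a) (G.F.obj b) ≫ H.F.map (G.f2 a b)
  f2_nat p q := by
    have h := congrArg H.F.map (G.f2_nat p q)
    rw [H.F.map_comp, H.F.map_comp] at h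
    have h' := H.f2_nat (G.F.map p) (G.F.map q)
    simp only [Functor.comp_obj, Functor.comp_map, Category.assoc]
    rw [← h, ← Category.assoc, h', Category.assoc]
  ax_α a b c := by
    have h := congrArg H.F.map (G.ax_α a b c)
    simp only [H.F.map_comp] at h
    have h' := H.ax_α (G.F.obj a) (G.F.obj b) (G.F.obj c)
    simp only [Functor.comp_obj, Functor.comp_map, Category.assoc]
    rw [R.mMap_comp_id, R.mMap_id_comp, Category.assoc, Category.assoc, H.f2_nat_left,
      H.f2_nat_right, h, reassoc_of% h']
  ax_l a := by
    have h := congrArg H.F.map (G.ax_l a)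
    simp only [H.F.map_comp] at h
    simp only [Functor.comp_obj, Functor.comp_map, Category.assoc]
    rw [R.mMap_comp_id, Category.assoc, H.f2_nat_left, h, H.ax_l]
  ax_ρ a := by
    have h := congrArg H.F.map (G.ax_ρ a)
    simp only [H.F.map_comp] at h
    simp only [Functor.comp_obj, Functor.comp_map]
    rw [R.mMap_id_comp, Category.assoc, H.f2_nat_right, ← h, ← H.ax_ρ]
    simp only [Category.assoc]

end SkewMonoidal

/-- A skew monoidal category. -/
structure SkMon : Type (max (u + 1) (v + 1)) where
  C : Type u
  [cat : Category.{v} C]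
  S : SkewMonoidal C

attribute [instance] SkMon.cat

/-- The category of skew monoidal categories and lax monoidal functors. -/
instance : Category SkMon.{v, u} where
  Hom X Y := SkewMonoidal.Lax X.S Y.S
  id X := SkewMonoidal.Lax.id X.S
  comp F G := F.comp G
  id_comp G := by
    apply SkewMonoidal.Lax.ext
    · rfl
    · simp [SkewMonoidal.Lax.comp, SkewMonoidal.Lax.id]
    · simp [SkewMonoidal.Lax.comp, SkewMonoidal.Lax.id]
  comp_id G := by
    apply SkewMonoidal.Lax.ext
    · rfl
    · simp [SkewMonoidal.Lax.comp, SkewMonoidal.Lax.id]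
    · simp [SkewMonoidal.Lax.comp, SkewMonoidal.Lax.id]
  assoc F G H := by
    apply SkewMonoidal.Lax.ext
    · rfl
    · simp [SkewMonoidal.Lax.comp]
    · simp [SkewMonoidal.Lax.comp]

namespace SkewMonoidal

/-- A braiding on a skew monoidal category. -/
structure Braiding {C : Type u} [Category.{v} C] (S : SkewMonoidal C) where
  s : ∀ x a b : C, S.m (S.m x a) b ≅ S.m (S.m x b) a
  s_nat : ∀ {x x' a a' b b' : C} (f : x ⟶ x') (g : a ⟶ a') (h : b ⟶ b'),
    S.mMap (S.mMap f g) h ≫ (s x' a' b').hom = (s x a b).hom ≫ S.mMap (S.mMap f h) g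
  ax_sss : ∀ x a b c : C,
    (s (S.m x a) b c).hom ≫ S.mMap (s x a c).hom (𝟙 b) ≫ (s (S.m x c) a b).hom =
      S.mMap (s x a b).hom (𝟙 c) ≫ (s (S.m x b) a c).hom ≫ S.mMap (s x b c).hom (𝟙 a)
  ax_sα₁ : ∀ x a b c : C,
    S.mMap (s x a b).hom (𝟙 c) ≫ (s (S.m x b) a c).hom ≫ S.mMap (S.α x b c) (𝟙 a) =
      S.α (S.m x a) b c ≫ (s x a (S.m b c)).hom
  ax_sα₂ : ∀ x a b c : C,
    (s (S.m x a) b c).hom ≫ S.mMap (s x a c).hom (𝟙 b) ≫ S.α (S.m x c) a b =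
      S.mMap (S.α x a b) (𝟙 c) ≫ (s x (S.m a b) c).hom
  ax_αs : ∀ x a b c : C,
    S.mMap (S.α x a b) (𝟙 c) ≫ S.α x (S.m a b) c ≫ S.mMap (𝟙 x) (s a b c).hom =
      (s (S.m x a) b c).hom ≫ S.mMap (S.α x a c) (𝟙 b) ≫ S.α x (S.m a c) b

/-- A braiding is a symmetry if `s_{x,b,a} = (s_{x,a,b})⁻¹`. -/
def Braiding.IsSymmetry {C : Type u} [Category.{v} C] {S : SkewMonoidal C}
    (B : S.Braiding) : Prop :=
  ∀ x a b : C, (B.s x b a).hom = (B.s x a b).inv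

/-- A lax monoidal functor is braided if it preserves the braiding. -/
def Lax.IsBraided {C D : Type u} [Category.{v} C] [Category.{v} D] {S : SkewMonoidal C}
    {T : SkewMonoidal D} (G : Lax S T) (B : S.Braiding) (B' : T.Braiding) : Prop :=
  ∀ x a b : C,
    (B'.s (G.F.obj x) (G.F.obj a) (G.F.obj b)).hom ≫
        T.mMap (G.f2 x b) (𝟙 (G.F.obj a)) ≫ G.f2 (S.m x b) a =
      T.mMap (G.f2 x a) (𝟙 (G.F.obj b)) ≫ G.f2 (S.m x a) b ≫ G.F.map (B.s x a b).hom

end SkewMonoidal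

/-- A braided skew monoidal category. -/
structure BrdSkMon : Type (max (u + 1) (v + 1)) extends SkMon.{v, u} where
  B : S.Braiding

/-- A morphism of braided skew monoidal categories. -/
@[ext]
structure BrdSkMon.Hom (X Y : BrdSkMon.{v, u}) where
  hom : X.toSkMon ⟶ Y.toSkMon
  isBraided : SkewMonoidal.Lax.IsBraided hom X.B Y.B

theorem SkewMonoidal.Lax.isBraided_id {C : Type u} [Category.{v} C] {S : SkewMonoidal C}
    (B : S.Braiding) : (Lax.id S).IsBraided B B := by
  intro x a b
  simp [Lax.id, S.mMap_id]

theorem SkewMonoidal.Lax.IsBraided.comp {C D E : Type u} [Category.{v} C] [Category.{v} D]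
    [Category.{v} E] {S : SkewMonoidal C} {T : SkewMonoidal D} {R : SkewMonoidal E}
    {G : Lax S T} {H : Lax T R} {B : S.Braiding} {B' : T.Braiding} {B'' : R.Braiding}
    (hG : G.IsBraided B B') (hH : H.IsBraided B' B'') : (G.comp H).IsBraided B B'' := by
  intro x a b
  have h := congrArg H.F.map (hG x a b)
  simp only [H.F.map_comp] at h
  have h' := hH (G.F.obj x) (G.F.obj a) (G.F.obj b)
  simp only [Lax.comp, Functor.comp_obj, Functor.comp_map, Category.assoc]
  rw [R.mMap_comp_id, R.mMap_comp_id, Category.assoc, Category.assoc, H.f2_nat_left,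
    H.f2_nat_left, ← h, reassoc_of% h']

/-- The category of braided skew monoidal categories and braided lax monoidal functors. -/
instance : Category BrdSkMon.{v, u} where
  Hom X Y := BrdSkMon.Hom X Y
  id X := ⟨𝟙 X.toSkMon, SkewMonoidal.Lax.isBraided_id X.B⟩
  comp G H := ⟨G.hom ≫ H.hom, G.isBraided.comp H.isBraided⟩
  id_comp _ := BrdSkMon.Hom.ext (Category.id_comp _)
  comp_id _ := BrdSkMon.Hom.ext (Category.comp_id _)
  assoc _ _ _ := BrdSkMon.Hom.ext (Category.assoc _ _ _)

/-- The category of symmetric skew monoidal categories, a full subcategory of the braided ones. -/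
abbrev SymSkMon : Type (max (u + 1) (v + 1)) :=
  ObjectProperty.FullSubcategory (C := BrdSkMon.{v, u}) fun X => X.B.IsSymmetry

/-! ### The skew monoidal category of a left representable short skew multicategory -/

namespace ShortSkewMulti

section

variable {C : Type u} [Category.{v} C] (M : ShortSkewMulti C)

/-! Naturality of the substitutions in single variables. -/

theorem bb₁_post {a₁ a₂ b₁ b₂ c c' : C} (q : c ⟶ c') (f : M.T2 b₁ b₂ c) (g : M.T2 a₁ a₂ b₁) :
    M.bb₁ (M.T2.act (𝟙 _) (𝟙 _) q f) g = M.T3.act (𝟙 _) (𝟙 _) (𝟙 _) q (M.bb₁ f g) := by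
  rw [← M.bb₁_nat, M.T2.act_id g]

theorem bb₂_post {a₁ a₂ b₁ b₂ c c' : C} (q : c ⟶ c') (f : M.T2 b₁ b₂ c) (g : M.T2 a₁ a₂ b₂) :
    M.bb₂ (M.T2.act (𝟙 _) (𝟙 _) q f) g = M.T3.act (𝟙 _) (𝟙 _) (𝟙 _) q (M.bb₂ f g) := by
  rw [← M.bb₂_nat, M.T2.act_id g]

theorem tb₁_post {a₁ a₂ b₁ b₂ b₃ c c' : C} (q : c ⟶ c') (f : M.T3 b₁ b₂ b₃ c)
    (g : M.T2 a₁ a₂ b₁) : M.tb₁ (M.T3.act (𝟙 _) (𝟙 _) (𝟙 _) q f) g =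
      M.T4.act (𝟙 _) (𝟙 _) (𝟙 _) (𝟙 _) q (M.tb₁ f g) := by
  rw [← M.tb₁_nat, M.T2.act_id g]

theorem tb₂_post {a₁ a₂ b₁ b₂ b₃ c c' : C} (q : c ⟶ c') (f : M.T3 b₁ b₂ b₃ c)
    (g : M.T2 a₁ a₂ b₂) : M.tb₂ (M.T3.act (𝟙 _) (𝟙 _) (𝟙 _) q f) g =
      M.T4.act (𝟙 _) (𝟙 _) (𝟙 _) (𝟙 _) q (M.tb₂ f g) := by
  rw [← M.tb₂_nat, M.T2.act_id g]

theorem tb₃_post {a₁ a₂ b₁ b₂ b₃ c c' : C} (q : c ⟶ c') (f : M.T3 b₁ b₂ b₃ c)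
    (g : M.T2 a₁ a₂ b₃) : M.tb₃ (M.T3.act (𝟙 _) (𝟙 _) (𝟙 _) q f) g =
      M.T4.act (𝟙 _) (𝟙 _) (𝟙 _) (𝟙 _) q (M.tb₃ f g) := by
  rw [← M.tb₃_nat, M.T2.act_id g]

theorem bt₁_post {a₁ a₂ a₃ b₁ b₂ c c' : C} (q : c ⟶ c') (f : M.T2 b₁ b₂ c)
    (g : M.T3 a₁ a₂ a₃ b₁) : M.bt₁ (M.T2.act (𝟙 _) (𝟙 _) q f) g =
      M.T4.act (𝟙 _) (𝟙 _) (𝟙 _) (𝟙 _) q (M.bt₁ f g) := by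
  rw [← M.bt₁_nat, M.T3.act_id g]

theorem bt₂_post {a₁ a₂ a₃ b₁ b₂ c c' : C} (q : c ⟶ c') (f : M.T2 b₁ b₂ c)
    (g : M.T3 a₁ a₂ a₃ b₂) : M.bt₂ (M.T2.act (𝟙 _) (𝟙 _) q f) g =
      M.T4.act (𝟙 _) (𝟙 _) (𝟙 _) (𝟙 _) q (M.bt₂ f g) := by
  rw [← M.bt₂_nat, M.T3.act_id g]

theorem bn₂_post {b₁ b₂ c c' : C} (q : c ⟶ c') (f : M.T2 b₁ b₂ c) (w : M.L0 b₂) :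
    M.bn₂ (M.T2.act (𝟙 _) (𝟙 _) q f) w = M.bn₂ f w ≫ q := by
  rw [M.bn₂_nat, Category.id_comp]

theorem ub_post {a₁ a₂ b c c' : C} (q : c ⟶ c') (f : M.L1 b c) (g : M.T2 a₁ a₂ b) :
    M.ub (M.L1.act (𝟙 _) q f) g = M.L2.act (𝟙 _) (𝟙 _) q (M.ub f g) := by
  rw [← M.ub_nat, M.T2.act_id g]

theorem bu₂_post {a b₁ b₂ c c' : C} (q : c ⟶ c') (f : M.T2 b₁ b₂ c) (g : M.L1 a b₂) :
    M.bu₂ (M.T2.act (𝟙 _) (𝟙 _) q f) g = M.T2.act (𝟙 _) (𝟙 _) q (M.bu₂ f g) := by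
  rw [← M.bu₂_nat, M.L1.act_id g]

theorem bb₁_pre₃ {a₁ a₂ b₁ b₂ b₂' c : C} (r : b₂' ⟶ b₂) (f : M.T2 b₁ b₂ c) (g : M.T2 a₁ a₂ b₁) :
    M.bb₁ (M.T2.act (𝟙 _) r (𝟙 _) f) g = M.T3.act (𝟙 _) (𝟙 _) r (𝟙 _) (M.bb₁ f g) := by
  rw [← M.bb₁_nat, M.T2.act_id g]

theorem bb₁_pre₁₂ {a₁ a₁' a₂ a₂' b₁ b₂ c : C} (p₁ : a₁' ⟶ a₁) (p₂ : a₂' ⟶ a₂)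
    (f : M.T2 b₁ b₂ c) (g : M.T2 a₁ a₂ b₁) :
    M.bb₁ f (M.T2.act p₁ p₂ (𝟙 _) g) = M.T3.act p₁ p₂ (𝟙 _) (𝟙 _) (M.bb₁ f g) := by
  rw [← M.bb₁_nat, M.T2.act_id f]

theorem bb₁_act {a₁ a₂ b₁ b₁' b₂ b₂' c : C} (s : b₁' ⟶ b₁) (r : b₂' ⟶ b₂) (f : M.T2 b₁ b₂ c)
    (g : M.T2 a₁ a₂ b₁') : M.bb₁ (M.T2.act s r (𝟙 _) f) g =
      M.T3.act (𝟙 _) (𝟙 _) r (𝟙 _) (M.bb₁ f (M.T2.act (𝟙 _) (𝟙 _) s g)) := by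
  rw [← M.bb₁_pre₃, ← M.bb₁_dinat, M.T2.act_act]
  simp

theorem bb₂_act {a₁ a₂ b₁ b₁' b₂ b₂' c : C} (r : b₁' ⟶ b₁) (s : b₂' ⟶ b₂) (f : M.T2 b₁ b₂ c)
    (g : M.T2 a₁ a₂ b₂') : M.bb₂ (M.T2.act r s (𝟙 _) f) g =
      M.bb₂ (M.T2.act r (𝟙 _) (𝟙 _) f) (M.T2.act (𝟙 _) (𝟙 _) s g) := by
  rw [← M.bb₂_dinat, M.T2.act_act]
  simp

end

namespace Classifiers

variable {C : Type u} [Category.{v} C] {M : ShortSkewMulti C} (R : M.Classifiers)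

/-- The ternary map `θ_{ab,c} ∘₁ θ_{a,b}`. -/
def θ3 (a b c : C) : M.T3 a b c (R.m (R.m a b) c) := M.bb₁ (R.θ (R.m a b) c) (R.θ a b)

/-- The quaternary map `(θ_{(ab)c,d} ∘₁ θ_{ab,c}) ∘₁ θ_{a,b}`. -/
def θ4 (a b c d : C) : M.T4 a b c d (R.m (R.m (R.m a b) c) d) :=
  M.tb₁ (R.θ3 (R.m a b) c d) (R.θ a b)

theorem θ4_eq (a b c d : C) :
    R.θ4 a b c d = M.bt₁ (R.θ (R.m (R.m a b) c) d) (R.θ3 a b c) := by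
  rw [θ4, θ3, θ3, M.ass_a₁₁]

theorem bij_θ3 (a b c d : C) : Function.Bijective
    (fun f : R.m (R.m a b) c ⟶ d => M.T3.act (𝟙 _) (𝟙 _) (𝟙 _) f (R.θ3 a b c)) := by
  convert ((R.θ_univ a b).bij₂ c d).comp ((R.θ_univ (R.m a b) c).bij₁ d) using 2 with f
  simp only [Function.comp_apply, θ3, M.bb₁_post]

theorem bij_θ4 (a b c d e : C) : Function.Bijective
    (fun f : R.m (R.m (R.m a b) c) d ⟶ e =>
      M.T4.act (𝟙 _) (𝟙 _) (𝟙 _) (𝟙 _) f (R.θ4 a b c d)) := by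
  convert ((R.θ_univ a b).bij₃ c d e).comp (R.bij_θ3 (R.m a b) c d e) using 2 with f
  simp only [Function.comp_apply, θ4, M.tb₁_post]

theorem bij_θu (a d : C) : Function.Bijective
    (fun f : R.m R.i a ⟶ d => M.L1.act (𝟙 _) f (M.bn₁ (R.θ R.i a) R.u)) := by
  convert (R.u_univ.bij₁ a d).comp ((R.θ_univ R.i a).bij₁ d) using 2 with f
  simp only [Function.comp_apply, M.bn₁_nat]

theorem bij_θ3u (a b d : C) : Function.Bijective
    (fun f : R.m (R.m R.i a) b ⟶ d =>
      M.L2.act (𝟙 _) (𝟙 _) f (M.tn₁ (R.θ3 R.i a b) R.u)) := by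
  convert (R.u_univ.bij₂ a b d).comp (R.bij_θ3 R.i a b d) using 2 with f
  simp only [Function.comp_apply, M.tn₁_nat]

/-- The unique map `f` with `f ∘ θ_{a,b} = g`. -/
noncomputable def lift {a b d : C} (g : M.T2 a b d) : R.m a b ⟶ d :=
  (((R.θ_univ a b).bij₁ d).2 g).choose

theorem lift_spec {a b d : C} (g : M.T2 a b d) :
    M.T2.act (𝟙 _) (𝟙 _) (R.lift g) (R.θ a b) = g :=
  (((R.θ_univ a b).bij₁ d).2 g).choose_spec

/-- The unique map `f` with `f ∘ (θ_{ab,c} ∘₁ θ_{a,b}) = g`. -/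
noncomputable def lift3 {a b c d : C} (g : M.T3 a b c d) : R.m (R.m a b) c ⟶ d :=
  ((R.bij_θ3 a b c d).2 g).choose

theorem lift3_spec {a b c d : C} (g : M.T3 a b c d) :
    M.T3.act (𝟙 _) (𝟙 _) (𝟙 _) (R.lift3 g) (R.θ3 a b c) = g :=
  ((R.bij_θ3 a b c d).2 g).choose_spec

/-- The unique map `f` with `f ∘ (θ_{i,a} ∘₁ u) = g`. -/
noncomputable def liftU {a d : C} (g : M.L1 a d) : R.m R.i a ⟶ d :=
  ((R.bij_θu a d).2 g).choose

theorem liftU_spec {a d : C} (g : M.L1 a d) :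
    M.L1.act (𝟙 _) (R.liftU g) (M.bn₁ (R.θ R.i a) R.u) = g :=
  ((R.bij_θu a d).2 g).choose_spec

/-- The unique map `f` with `f ∘ u = g`. -/
noncomputable def lift0 {d : C} (g : M.L0 d) : R.i ⟶ d := ((R.u_univ.bij₀ d).2 g).choose

theorem lift0_spec {d : C} (g : M.L0 d) : M.L0.act (R.lift0 g) R.u = g :=
  ((R.u_univ.bij₀ d).2 g).choose_spec

/-- The tensor product of morphisms: `fg ∘ θ_{a,b} = θ_{a',b'} ∘ (f, g)`. -/
noncomputable def mMap {a a' b b' : C} (f : a ⟶ a') (g : b ⟶ b') : R.m a b ⟶ R.m a' b' :=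
  R.lift (M.T2.act f g (𝟙 _) (R.θ a' b'))

theorem mMap_spec {a a' b b' : C} (f : a ⟶ a') (g : b ⟶ b') :
    M.T2.act (𝟙 _) (𝟙 _) (R.mMap f g) (R.θ a b) = M.T2.act f g (𝟙 _) (R.θ a' b') :=
  R.lift_spec _

/-- The associator: `α ∘ (θ_{ab,c} ∘₁ θ_{a,b}) = θ_{a,bc} ∘₂ θ_{b,c}`. -/
noncomputable def α (a b c : C) : R.m (R.m a b) c ⟶ R.m a (R.m b c) :=
  R.lift3 (M.bb₂ (R.θ a (R.m b c)) (R.θ b c))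

theorem α_spec (a b c : C) : M.T3.act (𝟙 _) (𝟙 _) (𝟙 _) (R.α a b c) (R.θ3 a b c) =
    M.bb₂ (R.θ a (R.m b c)) (R.θ b c) :=
  R.lift3_spec _

/-- The left unit map: `λ ∘ (θ_{i,a} ∘₁ u) = j(1_a)`. -/
noncomputable def l (a : C) : R.m R.i a ⟶ a := R.liftU (M.j1 (𝟙 a))

theorem l_spec (a : C) :
    M.L1.act (𝟙 _) (R.l a) (M.bn₁ (R.θ R.i a) R.u) = M.j1 (𝟙 a) :=
  R.liftU_spec _

/-- The right unit map `θ_{a,i} ∘₂ u`. -/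
def ρ (a : C) : a ⟶ R.m a R.i := M.bn₂ (R.θ a R.i) R.u

theorem ext2 {a b d : C} {f g : R.m a b ⟶ d}
    (h : M.T2.act (𝟙 _) (𝟙 _) f (R.θ a b) = M.T2.act (𝟙 _) (𝟙 _) g (R.θ a b)) : f = g :=
  ((R.θ_univ a b).bij₁ d).1 h

theorem ext3 {a b c d : C} {f g : R.m (R.m a b) c ⟶ d}
    (h : M.T3.act (𝟙 _) (𝟙 _) (𝟙 _) f (R.θ3 a b c) = M.T3.act (𝟙 _) (𝟙 _) (𝟙 _) g (R.θ3 a b c)) :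
    f = g :=
  (R.bij_θ3 a b c d).1 h

theorem ext4 {a b c d e : C} {f g : R.m (R.m (R.m a b) c) d ⟶ e}
    (h : M.T4.act (𝟙 _) (𝟙 _) (𝟙 _) (𝟙 _) f (R.θ4 a b c d) =
      M.T4.act (𝟙 _) (𝟙 _) (𝟙 _) (𝟙 _) g (R.θ4 a b c d)) : f = g :=
  (R.bij_θ4 a b c d e).1 h

/-! Postcomposition with composites, and the effect of the structure maps on the classifiers. -/

theorem post0 {a b c : C} (f : a ⟶ b) (g : b ⟶ c) (w : M.L0 a) :
    M.L0.act (f ≫ g) w = M.L0.act g (M.L0.act f w) := (M.L0.act_act f g w).symm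

theorem postL1 {x a b c : C} (f : a ⟶ b) (g : b ⟶ c) (w : M.L1 x a) :
    M.L1.act (𝟙 _) (f ≫ g) w = M.L1.act (𝟙 _) g (M.L1.act (𝟙 _) f w) := by
  rw [M.L1.act_act]; simp

theorem postL2 {x y a b c : C} (f : a ⟶ b) (g : b ⟶ c) (w : M.L2 x y a) :
    M.L2.act (𝟙 _) (𝟙 _) (f ≫ g) w = M.L2.act (𝟙 _) (𝟙 _) g (M.L2.act (𝟙 _) (𝟙 _) f w) := by
  rw [M.L2.act_act]; simp

theorem post2 {x y a b c : C} (f : a ⟶ b) (g : b ⟶ c) (w : M.T2 x y a) :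
    M.T2.act (𝟙 _) (𝟙 _) (f ≫ g) w = M.T2.act (𝟙 _) (𝟙 _) g (M.T2.act (𝟙 _) (𝟙 _) f w) := by
  rw [M.T2.act_act]; simp

theorem post3 {x y z a b c : C} (f : a ⟶ b) (g : b ⟶ c) (w : M.T3 x y z a) :
    M.T3.act (𝟙 _) (𝟙 _) (𝟙 _) (f ≫ g) w =
      M.T3.act (𝟙 _) (𝟙 _) (𝟙 _) g (M.T3.act (𝟙 _) (𝟙 _) (𝟙 _) f w) := by
  rw [M.T3.act_act]; simp

theorem post4 {x y z t a b c : C} (f : a ⟶ b) (g : b ⟶ c) (w : M.T4 x y z t a) :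
    M.T4.act (𝟙 _) (𝟙 _) (𝟙 _) (𝟙 _) (f ≫ g) w =
      M.T4.act (𝟙 _) (𝟙 _) (𝟙 _) (𝟙 _) g (M.T4.act (𝟙 _) (𝟙 _) (𝟙 _) (𝟙 _) f w) := by
  rw [M.T4.act_act]; simp

theorem pre_post2 {x x' y y' a b : C} (p : x' ⟶ x) (q : y' ⟶ y) (f : a ⟶ b) (w : M.T2 x y a) :
    M.T2.act (𝟙 _) (𝟙 _) f (M.T2.act p q (𝟙 _) w) =
      M.T2.act p q (𝟙 _) (M.T2.act (𝟙 _) (𝟙 _) f w) := by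
  rw [M.T2.act_act, M.T2.act_act]; simp

theorem pre_post3 {x x' y y' z z' a b : C} (p : x' ⟶ x) (q : y' ⟶ y) (r : z' ⟶ z) (f : a ⟶ b)
    (w : M.T3 x y z a) :
    M.T3.act (𝟙 _) (𝟙 _) (𝟙 _) f (M.T3.act p q r (𝟙 _) w) =
      M.T3.act p q r (𝟙 _) (M.T3.act (𝟙 _) (𝟙 _) (𝟙 _) f w) := by
  rw [M.T3.act_act, M.T3.act_act]; simp

/-- `(fg)h ∘ θ3 = θ3 ∘ (f, g, h)`. -/
theorem mMap_θ3 {a a' b b' c c' : C} (f : a ⟶ a') (g : b ⟶ b') (h : c ⟶ c') :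
    M.T3.act (𝟙 _) (𝟙 _) (𝟙 _) (R.mMap (R.mMap f g) h) (R.θ3 a b c) =
      M.T3.act f g h (𝟙 _) (R.θ3 a' b' c') := by
  rw [θ3, ← M.bb₁_post, R.mMap_spec, M.bb₁_act, R.mMap_spec, M.bb₁_pre₁₂, M.T3.act_act, θ3]
  simp

/-- `f·c ∘ θ3 = θ_{d,c} ∘₁ (f ∘ θ_{a,b})`. -/
theorem mMap_left_θ3 {a b c d : C} (f : R.m a b ⟶ d) :
    M.T3.act (𝟙 _) (𝟙 _) (𝟙 _) (R.mMap f (𝟙 c)) (R.θ3 a b c) =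
      M.bb₁ (R.θ d c) (M.T2.act (𝟙 _) (𝟙 _) f (R.θ a b)) := by
  rw [θ3, ← M.bb₁_post, R.mMap_spec, M.bb₁_dinat]

theorem mMap_left_θ4 {a b c d e : C} (f : R.m (R.m a b) c ⟶ e) :
    M.T4.act (𝟙 _) (𝟙 _) (𝟙 _) (𝟙 _) (R.mMap f (𝟙 d)) (R.θ4 a b c d) =
      M.bt₁ (R.θ e d) (M.T3.act (𝟙 _) (𝟙 _) (𝟙 _) f (R.θ3 a b c)) := by
  rw [θ4_eq, ← M.bt₁_post, R.mMap_spec, M.bt₁_dinat]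

/-- `α_{ab,c,d} ∘ θ4 = θ3_{a,b,cd} ∘₃ θ_{c,d}`. -/
theorem α_θ4 (a b c d : C) :
    M.T4.act (𝟙 _) (𝟙 _) (𝟙 _) (𝟙 _) (R.α (R.m a b) c d) (R.θ4 a b c d) =
      M.tb₃ (R.θ3 a b (R.m c d)) (R.θ c d) := by
  rw [θ4, ← M.tb₁_post, R.α_spec, θ3, M.comm_a]

/-- `α_{a,b,c}·d ∘ θ4 = θ3_{a,bc,d} ∘₂ θ_{b,c}`. -/
theorem αd_θ4 (a b c d : C) :
    M.T4.act (𝟙 _) (𝟙 _) (𝟙 _) (𝟙 _) (R.mMap (R.α a b c) (𝟙 d)) (R.θ4 a b c d) =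
      M.tb₂ (R.θ3 a (R.m b c) d) (R.θ b c) := by
  rw [mMap_left_θ4, R.α_spec, M.ass_a₁₂, θ3]

/-- `α_{a,bc,d} ∘ (α_{a,b,c}·d) ∘ θ4 = θ_{a,(bc)d} ∘₂ θ3_{b,c,d}`. -/
theorem ααd_θ4 (a b c d : C) :
    M.T4.act (𝟙 _) (𝟙 _) (𝟙 _) (𝟙 _) (R.mMap (R.α a b c) (𝟙 d) ≫ R.α a (R.m b c) d)
      (R.θ4 a b c d) = M.bt₂ (R.θ a (R.m (R.m b c) d)) (R.θ3 b c d) := by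
  rw [post4, αd_θ4, ← M.tb₂_post, R.α_spec, ← M.ass_a₂₁, θ3]

theorem bt₂_mMap {x a b c d e : C} (f : d ⟶ e) (g : M.T3 a b c d) :
    M.T4.act (𝟙 _) (𝟙 _) (𝟙 _) (𝟙 _) (R.mMap (𝟙 x) f) (M.bt₂ (R.θ x d) g) =
      M.bt₂ (R.θ x e) (M.T3.act (𝟙 _) (𝟙 _) (𝟙 _) f g) := by
  rw [← M.bt₂_post, R.mMap_spec, M.bt₂_dinat]

/-- The skew monoidal structure given by the classifiers. -/
noncomputable def skewMonoidal : SkewMonoidal C where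
  m := R.m
  mMap f g := R.mMap f g
  mMap_id a b := R.ext2 (by rw [R.mMap_spec])
  mMap_comp f f' g g' := R.ext2 (by
    rw [R.mMap_spec, post2, R.mMap_spec, pre_post2, R.mMap_spec, M.T2.act_act]
    simp)
  i := R.i
  α := R.α
  l := R.l
  ρ := R.ρ
  α_nat f g h := R.ext3 (by
    rw [post3, post3, R.mMap_θ3, R.α_spec, pre_post3, R.α_spec, ← M.bb₂_post, R.mMap_spec,
      M.bb₂_act, R.mMap_spec, M.bb₂_nat])
  l_nat {a a'} f := (R.bij_θu a a').1 (by
    dsimp only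
    rw [postL1, postL1, R.l_spec, ← M.bn₁_nat, R.mMap_spec, M.bn₁_nat, M.L1.act_act]
    have h := R.l_spec a'
    rw [← M.j1_nat]
    have h2 : M.j1 (f ≫ 𝟙 a' ≫ 𝟙 a') = _ := M.j1_nat f (𝟙 a') (𝟙 a')
    rw [← R.l_spec a', M.L1.act_act] at h2
    simpa using h2.symm)
  ρ_nat {a a'} f := by
    rw [ρ, ρ, ← M.bn₂_post, R.mMap_spec, M.bn₂_nat, Category.comp_id]
  pentagon a b c d := R.ext4 (by
    rw [← Category.assoc, post4, post4, α_θ4, ααd_θ4, bt₂_mMap, R.α_spec, ← M.tb₃_post,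
      R.α_spec, M.ass_a₂₂])
  ax_iab a b := (R.bij_θ3u a b _).1 (by
    dsimp only
    rw [postL2, ← M.tn₁_nat, R.α_spec, ← M.comm_c, ← M.ub_post, R.l_spec, M.ub_j, M.T2.act_id,
      ← M.tn₁_nat, R.mMap_left_θ3, ← M.ass_b₁₁, M.bn₁_nat, R.l_spec, M.bu₁_j, M.T2.act_id])
  ax_abi a b := R.ext2 (by
    rw [post2, ρ, ← M.comm_b, ← M.tn₃_nat]
    erw [R.α_spec]
    rw [← M.ass_b₂₂, R.mMap_spec, ρ])
  ax_aib a b := R.ext2 (by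
    rw [post2, post2, R.mMap_spec, ρ, M.ass_b₁₂, ← M.tn₂_nat]
    erw [R.α_spec]
    rw [← M.ass_b₂₁, ← M.bu₂_post, R.mMap_spec, M.bu₂_dinat, R.l_spec, M.bu₂_j])
  ax_ii := (R.u_univ.bij₀ _).1 (by
    dsimp only
    rw [post0, ρ, ← M.comm_d, ← M.un_nat, R.l_spec, M.un_j])

/-! ### The braiding induced by a short braiding -/

variable (B : M.ShortBraiding)

/-- The map `s : (xa)b ⟶ (xb)a` with `s ∘ θ3_{x,a,b} = β³₂ θ3_{x,b,a}`. -/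
noncomputable def s (x a b : C) : R.m (R.m x a) b ⟶ R.m (R.m x b) a :=
  R.lift3 (B.β32 (R.θ3 x b a))

theorem s_spec (x a b : C) :
    M.T3.act (𝟙 _) (𝟙 _) (𝟙 _) (R.s B x a b) (R.θ3 x a b) = B.β32 (R.θ3 x b a) :=
  R.lift3_spec _

/-- The inverse of `s`, with `sInv ∘ θ3_{x,b,a} = (β³₂)⁻¹ θ3_{x,a,b}`. -/
noncomputable def sInv (x a b : C) : R.m (R.m x b) a ⟶ R.m (R.m x a) b :=
  R.lift3 (B.β32.symm (R.θ3 x a b))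

theorem sInv_spec (x a b : C) :
    M.T3.act (𝟙 _) (𝟙 _) (𝟙 _) (R.sInv B x a b) (R.θ3 x b a) = B.β32.symm (R.θ3 x a b) :=
  R.lift3_spec _

theorem s_sInv (x a b : C) : R.s B x a b ≫ R.sInv B x a b = 𝟙 _ := R.ext3 (by
  rw [post3, R.s_spec, ← B.β32_nat, R.sInv_spec, Equiv.apply_symm_apply, M.T3.act_id])

theorem sInv_s (x a b : C) : R.sInv B x a b ≫ R.s B x a b = 𝟙 _ := R.ext3 (by
  rw [post3, R.sInv_spec, M.T3.act_id, ← Equiv.apply_eq_iff_eq B.β32, B.β32_nat,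
    Equiv.apply_symm_apply, R.s_spec])

theorem s_θ4 (x a b c : C) :
    M.T4.act (𝟙 _) (𝟙 _) (𝟙 _) (𝟙 _) (R.s B (R.m x a) b c) (R.θ4 x a b c) =
      B.β43 (R.θ4 x a c b) := by
  rw [θ4, ← M.tb₁_post, R.s_spec, ← B.tb₁_β, θ4]

theorem sc_θ4 (x a b c : C) :
    M.T4.act (𝟙 _) (𝟙 _) (𝟙 _) (𝟙 _) (R.mMap (R.s B x a b) (𝟙 c)) (R.θ4 x a b c) =
      B.β42 (R.θ4 x b a c) := by
  rw [mMap_left_θ4, R.s_spec, B.bt₁_β, ← θ4_eq]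

/-- The braiding on the skew monoidal category induced by a short braiding. -/
noncomputable def braiding : R.skewMonoidal.Braiding where
  s x a b :=
    { hom := R.s B x a b
      inv := R.sInv B x a b
      hom_inv_id := R.s_sInv B x a b
      inv_hom_id := R.sInv_s B x a b }
  s_nat f g h := R.ext3 (by
    change M.T3.act _ _ _ (R.mMap (R.mMap f g) h ≫ R.s B _ _ _) _ =
      M.T3.act _ _ _ (R.s B _ _ _ ≫ R.mMap (R.mMap f h) g) _
    rw [post3, post3, R.mMap_θ3, pre_post3, R.s_spec, R.s_spec, ← B.β32_nat, ← B.β32_nat,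
      R.mMap_θ3])
  ax_sss x a b c := R.ext4 (by
    change M.T4.act _ _ _ _
        (R.s B (R.m x a) b c ≫ R.mMap (R.s B x a c) (𝟙 b) ≫ R.s B (R.m x c) a b) _ =
      M.T4.act _ _ _ _
        (R.mMap (R.s B x a b) (𝟙 c) ≫ R.s B (R.m x b) a c ≫ R.mMap (R.s B x b c) (𝟙 a)) _
    rw [post4, post4, post4, post4, R.s_θ4, R.sc_θ4, ← B.β43_nat, R.sc_θ4, ← B.β42_nat, R.s_θ4,
      ← B.β43_nat, ← B.β42_nat, R.s_θ4, ← B.β42_nat, ← B.β43_nat, R.sc_θ4, B.braid])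
  ax_sα₁ x a b c := R.ext4 (by
    change M.T4.act _ _ _ _
        (R.mMap (R.s B x a b) (𝟙 c) ≫ R.s B (R.m x b) a c ≫ R.mMap (R.α x b c) (𝟙 a)) _ =
      M.T4.act _ _ _ _ (R.α (R.m x a) b c ≫ R.s B x a (R.m b c)) _
    rw [post4, post4, post4, R.sc_θ4, ← B.β42_nat, R.s_θ4, ← B.β42_nat, ← B.β43_nat, R.αd_θ4,
      R.α_θ4, ← M.tb₃_post, R.s_spec, B.tb₂_β])
  ax_sα₂ x a b c := R.ext4 (by
    change M.T4.act _ _ _ _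
        (R.s B (R.m x a) b c ≫ R.mMap (R.s B x a c) (𝟙 b) ≫ R.α (R.m x c) a b) _ =
      M.T4.act _ _ _ _ (R.mMap (R.α x a b) (𝟙 c) ≫ R.s B x (R.m a b) c) _
    rw [post4, post4, post4, R.s_θ4, ← B.β43_nat, R.sc_θ4, ← B.β43_nat, ← B.β42_nat, R.α_θ4,
      R.αd_θ4, ← M.tb₂_post, R.s_spec, B.tb₃_β])
  ax_αs x a b c := R.ext4 (by
    change M.T4.act _ _ _ _
        (R.mMap (R.α x a b) (𝟙 c) ≫ R.α x (R.m a b) c ≫ R.mMap (𝟙 x) (R.s B a b c)) _ =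
      M.T4.act _ _ _ _
        (R.s B (R.m x a) b c ≫ R.mMap (R.α x a c) (𝟙 b) ≫ R.α x (R.m a c) b) _
    rw [← Category.assoc, post4, R.ααd_θ4, R.bt₂_mMap, R.s_spec, B.bt₂_β, post4, R.s_θ4,
      ← B.β43_nat, R.ααd_θ4])

theorem braiding_isSymmetry {B : M.ShortBraiding} (hB : B.IsSymmetry) :
    (R.braiding B).IsSymmetry := fun x a b => R.ext3 (by
  change M.T3.act _ _ _ (R.s B x b a) _ = M.T3.act _ _ _ (R.sInv B x a b) _
  rw [R.s_spec, R.sInv_spec, Equiv.eq_symm_apply, hB])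

/-! ### The lax monoidal functor induced by a morphism -/

variable {D : Type u} [Category.{v} D] {N : ShortSkewMulti D} (R' : N.Classifiers) (G : Hom M N)

theorem map_post2 {x y a b : C} (f : a ⟶ b) (w : M.T2 x y a) :
    G.T2 (M.T2.act (𝟙 _) (𝟙 _) f w) = N.T2.act (𝟙 _) (𝟙 _) (G.F.map f) (G.T2 w) := by
  rw [G.T2_nat]; simp

theorem map_post3 {x y z a b : C} (f : a ⟶ b) (w : M.T3 x y z a) :
    G.T3 (M.T3.act (𝟙 _) (𝟙 _) (𝟙 _) f w) =
      N.T3.act (𝟙 _) (𝟙 _) (𝟙 _) (G.F.map f) (G.T3 w) := by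
  rw [G.T3_nat]; simp

/-- The map `f₂` with `f₂ ∘ θ_{Fa,Fb} = F θ_{a,b}`. -/
noncomputable def f2 (a b : C) : R'.m (G.F.obj a) (G.F.obj b) ⟶ G.F.obj (R.m a b) :=
  R'.lift (G.T2 (R.θ a b))

theorem f2_spec (a b : C) :
    N.T2.act (𝟙 _) (𝟙 _) (R.f2 R' G a b) (R'.θ (G.F.obj a) (G.F.obj b)) = G.T2 (R.θ a b) :=
  R'.lift_spec _

/-- The map `f₀` with `f₀ ∘ u = F u`. -/
noncomputable def f0 : R'.i ⟶ G.F.obj R.i := R'.lift0 (G.L0 R.u)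

theorem f0_spec : N.L0.act (R.f0 R' G) R'.u = G.L0 R.u := R'.lift0_spec _

theorem f2_θ3 (a b c : C) :
    N.T3.act (𝟙 _) (𝟙 _) (𝟙 _)
      (R'.mMap (R.f2 R' G a b) (𝟙 (G.F.obj c)) ≫ R.f2 R' G (R.m a b) c)
      (R'.θ3 (G.F.obj a) (G.F.obj b) (G.F.obj c)) = G.T3 (R.θ3 a b c) := by
  rw [post3, mMap_left_θ3, f2_spec, ← N.bb₁_post, f2_spec, ← G.map_bb₁, θ3]

/-- The lax monoidal functor induced by a morphism of short skew multicategories. -/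
noncomputable def lax : SkewMonoidal.Lax R.skewMonoidal R'.skewMonoidal where
  F := G.F
  f0 := R.f0 R' G
  f2 := R.f2 R' G
  f2_nat {a a' b b'} p q := R'.ext2 (by
    change N.T2.act _ _ (R'.mMap (G.F.map p) (G.F.map q) ≫ R.f2 R' G _ _) _ =
      N.T2.act _ _ (R.f2 R' G _ _ ≫ G.F.map (R.mMap p q)) _
    rw [post2, post2, f2_spec, R'.mMap_spec, pre_post2, f2_spec, ← map_post2, R.mMap_spec,
      G.T2_nat, G.F.map_id])
  ax_α a b c := R'.ext3 (by
    change N.T3.act _ _ _ (R'.mMap (R.f2 R' G a b) (𝟙 (G.F.obj c)) ≫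
        R.f2 R' G (R.m a b) c ≫ G.F.map (R.α a b c)) _ =
      N.T3.act _ _ _ (R'.α _ _ _ ≫ R'.mMap (𝟙 (G.F.obj a)) (R.f2 R' G b c) ≫
        R.f2 R' G a (R.m b c)) _
    rw [← Category.assoc, post3, f2_θ3, ← map_post3, R.α_spec, G.map_bb₂, post3, post3,
      R'.α_spec, ← N.bb₂_post, R'.mMap_spec, N.bb₂_dinat, f2_spec, ← N.bb₂_post, f2_spec])
  ax_l a := (R'.bij_θu (G.F.obj a) (G.F.obj a)).1 (by
    change N.L1.act _ (R'.mMap (R.f0 R' G) (𝟙 (G.F.obj a)) ≫ R.f2 R' G R.i a ≫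
      G.F.map (R.l a)) _ = N.L1.act _ (R'.l _) _
    have h := congrArg G.L1 (R.l_spec a)
    rw [G.L1_nat, G.map_bn₁, G.map_j1, G.F.map_id] at h
    rw [postL1, postL1, R'.l_spec, ← N.bn₁_nat, R'.mMap_spec, N.bn₁_dinat, f0_spec, ← N.bn₁_nat,
      f2_spec, h])
  ax_ρ a := by
    change R'.ρ _ ≫ R'.mMap (𝟙 (G.F.obj a)) (R.f0 R' G) ≫ R.f2 R' G a R.i = G.F.map (R.ρ a)
    rw [ρ, ρ, G.map_bn₂, ← Category.assoc, ← N.bn₂_post, R'.mMap_spec, N.bn₂_dinat, f0_spec,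
      ← N.bn₂_post, f2_spec]

theorem lax_isBraided {B : M.ShortBraiding} {B' : N.ShortBraiding} (hG : G.IsBraided B B') :
    (R.lax R' G).IsBraided (R.braiding B) (R'.braiding B') := by
  intro x a b
  change R'.s B' (G.F.obj x) (G.F.obj a) (G.F.obj b) ≫
      R'.mMap (R.f2 R' G x b) (𝟙 (G.F.obj a)) ≫ R.f2 R' G (R.m x b) a =
    R'.mMap (R.f2 R' G x a) (𝟙 (G.F.obj b)) ≫ R.f2 R' G (R.m x a) b ≫
      G.F.map (R.s B x a b)
  apply R'.ext3
  rw [post3, R'.s_spec, ← B'.β32_nat, f2_θ3, ← hG.β32, ← Category.assoc, post3, f2_θ3,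
    ← map_post3, R.s_spec]

theorem lax_id : R.lax R (Hom.id M) = SkewMonoidal.Lax.id R.skewMonoidal := by
  apply SkewMonoidal.Lax.ext
  · rfl
  · apply heq_of_eq
    apply (R.u_univ.bij₀ _).1
    exact (R.f0_spec R (Hom.id M)).trans (M.L0.act_id R.u).symm
  · apply heq_of_eq
    funext a b
    apply R.ext2
    exact (R.f2_spec R (Hom.id M) a b).trans (M.T2.act_id (R.θ a b)).symm

theorem lax_comp {E : Type u} [Category.{v} E] {P : ShortSkewMulti E} (R'' : P.Classifiers)
    (H : Hom N P) : R.lax R'' (G.comp H) = (R.lax R' G).comp (R'.lax R'' H) := by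
  apply SkewMonoidal.Lax.ext
  · rfl
  · apply heq_of_eq
    apply (R''.u_univ.bij₀ _).1
    change P.L0.act (R.f0 R'' (G.comp H)) R''.u =
      P.L0.act (R'.f0 R'' H ≫ H.F.map (R.f0 R' G)) R''.u
    rw [f0_spec, post0, f0_spec, ← H.L0_nat, f0_spec]
    rfl
  · apply heq_of_eq
    funext a b
    apply R''.ext2
    refine (R.f2_spec R'' (G.comp H) a b).trans ?_
    change H.T2 (G.T2 (R.θ a b)) = P.T2.act (𝟙 (H.F.obj (G.F.obj a))) (𝟙 (H.F.obj (G.F.obj b)))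
      (R'.f2 R'' H (G.F.obj a) (G.F.obj b) ≫ H.F.map (R.f2 R' G a b)) (R''.θ _ _)
    rw [post2, f2_spec, ← map_post2, f2_spec]

end Classifiers

end ShortSkewMulti

/-! ### The functors `K^s`, `K^brd` and `K^sym` -/

/-- A choice of left universal classifiers for every left representable short skew
multicategory. -/
abbrev ClassifierChoice : Type (max (u + 1) (v + 1)) :=
  ∀ X : FSMulti.{v, u}, X.M.IsLeftRepresentable → X.M.Classifiers

theorem nonempty_classifierChoice : Nonempty ClassifierChoice.{v, u} :=
  ⟨fun _ h => Classical.choice h.nonempty_classifiers⟩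

/-- The functor `K^s` from left representable short skew multicategories to skew monoidal
categories, with respect to a choice `R` of classifiers. -/
noncomputable def Ks (R : ClassifierChoice.{v, u}) : FSMultiLR.{v, u} ⥤ SkMon.{v, u} where
  obj X := ⟨X.obj.C, (R X.obj X.property).skewMonoidal⟩
  map {X Y} G := (R X.obj X.property).lax (R Y.obj Y.property) G.hom
  map_id X := (R X.obj X.property).lax_id
  map_comp {X Y Z} G H :=
    (R X.obj X.property).lax_comp (R Y.obj Y.property) G.hom (R Z.obj Z.property) H.hom

/-- The functor forgetting the short braiding. -/
def forgetFSMulti : BrdFSMultiLR.{v, u} ⥤ FSMultiLR.{v, u} where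
  obj X := ⟨X.obj.toFSMulti, X.property⟩
  map G := ObjectProperty.homMk G.hom.hom

/-- The lift `K^brd` of `K^s` to braided structures. -/
noncomputable def Kbrd (R : ClassifierChoice.{v, u}) : BrdFSMultiLR.{v, u} ⥤ BrdSkMon.{v, u} where
  obj X :=
    { toSkMon := (Ks R).obj (forgetFSMulti.obj X)
      B := (R X.obj.toFSMulti X.property).braiding X.obj.B }
  map {X Y} G :=
    { hom := (Ks R).map (forgetFSMulti.map G)
      isBraided := (R X.obj.toFSMulti X.property).lax_isBraided
        (R Y.obj.toFSMulti Y.property) G.hom.hom G.hom.isBraided }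
  map_id X := BrdSkMon.Hom.ext ((Ks R).map_id (forgetFSMulti.obj X))
  map_comp G H := BrdSkMon.Hom.ext ((Ks R).map_comp (forgetFSMulti.map G) (forgetFSMulti.map H))

/-- The functor `K^sym`, the restriction of `K^brd` to symmetric structures. -/
noncomputable def Ksym (R : ClassifierChoice.{v, u}) : SymFSMultiLR.{v, u} ⥤ SymSkMon.{v, u} :=
  ObjectProperty.lift _ (ObjectProperty.ιOfLE (fun _ h => h.2) ⋙ Kbrd R)
    (fun X => (R X.obj.toFSMulti X.property.2).braiding_isSymmetry X.property.1)

end ShortSkew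

namespace ShortSkew

open CategoryTheory

namespace ShortSkewMulti
namespace Classifiers

variable {C : Type u} [Category.{v} C] {M : ShortSkewMulti C} (R : M.Classifiers)
  {D : Type u} [Category.{v} D] {N : ShortSkewMulti D} (R' : N.Classifiers)

/-! ### Generation by the classifiers -/

/-! In a left representable short skew multicategory every multimap is built, in exactly one way,
from morphisms and the classifiers `u` and `θ`. A tight binary map is `q ∘ θ`, and tight maps of
arity three and four are `g ∘₁ θ` with `g` of smaller arity. A nullary map is `q ∘ u`, and the other
loose maps are `g ∘₁ u` with `g` tight.

Faithfulness (`hom_ext`): a morphism commutes with these substitutions, so its underlying functor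
and the images of the classifiers determine it. Those images are `f₂ ∘ θ` and `f₀ ∘ u`, which the
lax monoidal functor records.

Fullness (`ofLax`, `lax_ofLax`): for a lax monoidal functor the same decomposition forces the
definition on multimaps, and uniqueness of the decomposition makes it well defined. Naturality of
`f₂` gives naturality on tight binary maps. The associativity axiom gives compatibility with `θ ∘₂
θ`, the right unit axiom with `θ ∘₂ u`, the left unit axiom with `j`. All other compatibilities
follow by decomposing the arguments and applying the associativity and interchange laws of both
multicategories. Braidedness need only be tested on `θ3`, where it is the braiding condition on the
lax functor (`isBraided_of_lax`).

Essential surjectivity (`toMulti`, `nonempty_Kbrd_toMulti_iso`): in a skew monoidal category take as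
tight maps the morphisms out of left bracketed tensor products, and as loose maps those out of such
products with a unit put in front. Identities are then classifiers that return the given structure
exactly, and any other choice of classifiers gives an isomorphic one. The symmetric case is
inherited, since both constructions respect symmetry. -/

theorem exists_post {a b d : C} (f : M.T2 a b d) :
    ∃ q : R.m a b ⟶ d, M.T2.act (𝟙 _) (𝟙 _) q (R.θ a b) = f :=
  ((R.θ_univ a b).bij₁ d).2 f

theorem exists_bb₁ {a b c d : C} (f : M.T3 a b c d) :
    ∃ g : M.T2 (R.m a b) c d, M.bb₁ g (R.θ a b) = f :=
  ((R.θ_univ a b).bij₂ c d).2 f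

theorem exists_tb₁ {a b c d e : C} (f : M.T4 a b c d e) :
    ∃ g : M.T3 (R.m a b) c d e, M.tb₁ g (R.θ a b) = f :=
  ((R.θ_univ a b).bij₃ c d e).2 f

theorem exists_act {d : C} (w : M.L0 d) : ∃ q : R.i ⟶ d, M.L0.act q R.u = w :=
  (R.u_univ.bij₀ d).2 w

theorem exists_bn₁ {a d : C} (f : M.L1 a d) : ∃ g : M.T2 R.i a d, M.bn₁ g R.u = f :=
  (R.u_univ.bij₁ a d).2 f

theorem exists_tn₁ {a b d : C} (f : M.L2 a b d) : ∃ g : M.T3 R.i a b d, M.tn₁ g R.u = f :=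
  (R.u_univ.bij₂ a b d).2 f

/-! ### Faithfulness: a morphism is determined by its lax monoidal functor -/

/-- The functor, `f₀` and `f₂` fix the action on morphisms, `u` and `θ`, and these generate all
multimaps under substitution in the first slot. -/
theorem hom_ext {G H : Hom M N} (h : R.lax R' G = R.lax R' H) : G = H := by
  have hF : G.F = H.F := congrArg SkewMonoidal.Lax.F h
  have h0 : HEq (R.f0 R' G) (R.f0 R' H) := (SkewMonoidal.Lax.ext_iff.1 h).2.1
  have h2 : HEq (R.f2 R' G) (R.f2 R' H) := (SkewMonoidal.Lax.ext_iff.1 h).2.2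
  have s0 := R.f0_spec R' G
  have s0' := R.f0_spec R' H
  have s2 := R.f2_spec R' G
  have s2' := R.f2_spec R' H
  -- Only the defining equations of `f₀` and `f₂` matter. Making the maps themselves variables
  -- allows the two functors to be identified by substitution, after which the heterogeneous
  -- equalities become ordinary ones.
  generalize R.f0 R' G = x0 at *
  generalize R.f0 R' H = y0 at *
  generalize R.f2 R' G = x2 at *
  generalize R.f2 R' H = y2 at *
  clear h
  obtain ⟨F, T2, T3, T4, L0, L1, L2, T2n, T3n, T4n, L0n, L1n, L2n, _, _, b1, _, t1, _, _, _, _,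
    n1, _, tn, _, _, _, _, _, _⟩ := G
  obtain ⟨F', T2', T3', T4', L0', L1', L2', T2n', T3n', T4n', L0n', L1n', L2n', _, _, b1', _,
    t1', _, _, _, _, n1', _, tn', _, _, _, _, _, _⟩ := H
  dsimp only at hF
  subst hF
  cases h0
  cases h2
  dsimp only at *
  -- The order of the families matters: each is generated from the families already identified and a
  -- classifier.
  have e2 : @T2 = @T2' := by
    funext a b c f
    obtain ⟨q, rfl⟩ := R.exists_post f
    rw [T2n, T2n', ← s2, s2']
  subst e2
  have e3 : @T3 = @T3' := by
    funext a b c d f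
    obtain ⟨g, rfl⟩ := R.exists_bb₁ f
    rw [b1, b1']
  subst e3
  have e4 : @T4 = @T4' := by
    funext a b c d e f
    obtain ⟨g, rfl⟩ := R.exists_tb₁ f
    rw [t1, t1']
  subst e4
  have e0 : @L0 = @L0' := by
    funext a w
    obtain ⟨g, rfl⟩ := R.exists_act w
    rw [L0n, L0n', ← s0, s0']
  subst e0
  have e1 : @L1 = @L1' := by
    funext a b w
    obtain ⟨g, rfl⟩ := R.exists_bn₁ w
    rw [n1, n1']
  subst e1
  have e1 : @L2 = @L2' := by
    funext a b c w
    obtain ⟨g, rfl⟩ := R.exists_tn₁ w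
    rw [tn, tn']
  subst e1
  rfl

end Classifiers
end ShortSkewMulti

namespace ShortSkewMulti
namespace Classifiers

variable {C : Type u} [Category.{v} C] {M : ShortSkewMulti C} {R : M.Classifiers}
  {D : Type u} [Category.{v} D] {N : ShortSkewMulti D} {R' : N.Classifiers}
  (G : SkewMonoidal.Lax R.skewMonoidal R'.skewMonoidal)

/-! ### The morphism induced by a lax monoidal functor -/

/-- The structure map `f₂`, between tensor products given by classifiers. -/
noncomputable def laxF2 (a b : C) : R'.m (G.F.obj a) (G.F.obj b) ⟶ G.F.obj (R.m a b) := G.f2 a b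

/-- The structure map `f₀`, between units given by classifiers. -/
noncomputable def laxF0 : R'.i ⟶ G.F.obj R.i := G.f0

/-- The image of the binary classifier under the morphism induced by a lax monoidal functor. -/
noncomputable def laxθ (a b : C) : N.T2 (G.F.obj a) (G.F.obj b) (G.F.obj (R.m a b)) :=
  N.T2.act (𝟙 _) (𝟙 _) (laxF2 G a b) (R'.θ _ _)

/-- The image of the nullary classifier under the morphism induced by a lax monoidal functor. -/
noncomputable def laxU : N.L0 (G.F.obj R.i) := N.L0.act (laxF0 G) R'.u

/-- This and the next three lemmas are the data axioms of a lax monoidal functor (naturality of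
`f₂`, associativity, left unit, right unit), rewritten as equations between the prospective images
of the classifiers. Only in this form are they used to build the morphism. -/
theorem map_mMap_laxθ {a a' b b' : C} (p : a ⟶ a') (q : b ⟶ b') :
    N.T2.act (𝟙 _) (𝟙 _) (G.F.map (R.mMap p q)) (laxθ G a b) =
      N.T2.act (G.F.map p) (G.F.map q) (𝟙 _) (laxθ G a' b') := by
  -- The axiom is restated with the operations of the classifiers in place of the fields of
  -- `skewMonoidal`, so that their defining equations can be rewritten with.
  have h : R'.mMap (G.F.map p) (G.F.map q) ≫ laxF2 G a' b' =
      laxF2 G a b ≫ G.F.map (R.mMap p q) := G.f2_nat p q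
  rw [laxθ, laxθ, ← pre_post2, ← R'.mMap_spec, ← post2, ← post2, h]

theorem map_α_laxθ (a b c : C) :
    N.T3.act (𝟙 _) (𝟙 _) (𝟙 _) (G.F.map (R.α a b c))
        (N.bb₁ (laxθ G (R.m a b) c) (laxθ G a b)) =
      N.bb₂ (laxθ G a (R.m b c)) (laxθ G b c) := by
  have h : R'.mMap (laxF2 G a b) (𝟙 (G.F.obj c)) ≫ laxF2 G (R.m a b) c ≫ G.F.map (R.α a b c) =
      R'.α (G.F.obj a) (G.F.obj b) (G.F.obj c) ≫ R'.mMap (𝟙 (G.F.obj a)) (laxF2 G b c) ≫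
        laxF2 G a (R.m b c) := G.ax_α a b c
  -- An equation of morphisms out of `((Fa)(Fb))(Fc)` becomes one of ternary maps by composing with
  -- the universal one.
  have h' := congrArg (fun k => N.T3.act (𝟙 _) (𝟙 _) (𝟙 _) k (R'.θ3 _ _ _)) h
  rw [post3, post3, mMap_left_θ3, post3, post3, R'.α_spec, ← N.bb₂_post, R'.mMap_spec,
    N.bb₂_dinat, ← N.bb₂_post, ← N.bb₁_post] at h'
  exact h'

theorem map_l_laxθ (a : C) :
    N.L1.act (𝟙 _) (G.F.map (R.l a)) (N.bn₁ (laxθ G R.i a) (laxU G)) = N.j1 (𝟙 _) := by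
  have h : R'.mMap (laxF0 G) (𝟙 (G.F.obj a)) ≫ laxF2 G R.i a ≫ G.F.map (R.l a) =
      R'.l (G.F.obj a) := G.ax_l a
  rw [← R'.l_spec, ← h, postL1, postL1, ← N.bn₁_nat (𝟙 _) (R'.mMap _ _), R'.mMap_spec,
    N.bn₁_dinat, ← N.bn₁_nat (𝟙 _) (laxF2 G _ _)]
  rfl

theorem bn₂_laxθ_laxU (a : C) : N.bn₂ (laxθ G a R.i) (laxU G) = G.F.map (R.ρ a) := by
  have h : R'.ρ (G.F.obj a) ≫ R'.mMap (𝟙 (G.F.obj a)) (laxF0 G) ≫ laxF2 G a R.i =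
      G.F.map (R.ρ a) := G.ax_ρ a
  rw [← h, ρ, ← Category.assoc, ← N.bn₂_post, R'.mMap_spec, N.bn₂_dinat, ← N.bn₂_post]
  rfl

/-- The action on tight binary maps: `f ∘ θ ↦ F f ∘ F θ`. -/
noncomputable def laxT2 {a b c : C} (f : M.T2 a b c) :
    N.T2 (G.F.obj a) (G.F.obj b) (G.F.obj c) :=
  N.T2.act (𝟙 _) (𝟙 _) (G.F.map (R.lift f)) (laxθ G a b)

/-- The action on tight ternary maps: `f ∘₁ θ ↦ F f ∘₁ F θ`. -/
noncomputable def laxT3 {a b c d : C} (f : M.T3 a b c d) :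
    N.T3 (G.F.obj a) (G.F.obj b) (G.F.obj c) (G.F.obj d) :=
  N.bb₁ (laxT2 G (R.exists_bb₁ f).choose) (laxθ G a b)

/-- The action on tight quaternary maps: `f ∘₁ θ ↦ F f ∘₁ F θ`. -/
noncomputable def laxT4 {a b c d e : C} (f : M.T4 a b c d e) :
    N.T4 (G.F.obj a) (G.F.obj b) (G.F.obj c) (G.F.obj d) (G.F.obj e) :=
  N.tb₁ (laxT3 G (R.exists_tb₁ f).choose) (laxθ G a b)

/-- The action on nullary maps: `f ∘ u ↦ F f ∘ F u`. -/
noncomputable def laxL0 {a : C} (f : M.L0 a) : N.L0 (G.F.obj a) :=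
  N.L0.act (G.F.map (R.lift0 f)) (laxU G)

/-- The action on loose unary maps: `f ∘₁ u ↦ F f ∘₁ F u`. -/
noncomputable def laxL1 {a b : C} (f : M.L1 a b) : N.L1 (G.F.obj a) (G.F.obj b) :=
  N.bn₁ (laxT2 G (R.exists_bn₁ f).choose) (laxU G)

/-- The action on loose binary maps: `f ∘₁ u ↦ F f ∘₁ F u`. -/
noncomputable def laxL2 {a b c : C} (f : M.L2 a b c) :
    N.L2 (G.F.obj a) (G.F.obj b) (G.F.obj c) :=
  N.tn₁ (laxT3 G (R.exists_tn₁ f).choose) (laxU G)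

/-- The families are defined through chosen preimages. Injectivity of the universal properties
identifies the chosen preimage with any given one; after this and the next five lemmas the choices
play no role. -/
theorem laxT2_post_θ {a b c : C} (q : R.m a b ⟶ c) :
    laxT2 G (M.T2.act (𝟙 _) (𝟙 _) q (R.θ a b)) =
      N.T2.act (𝟙 _) (𝟙 _) (G.F.map q) (laxθ G a b) := by
  rw [laxT2, R.ext2 (R.lift_spec _)]

theorem laxT3_bb₁_θ {a b c d : C} (f : M.T2 (R.m a b) c d) :
    laxT3 G (M.bb₁ f (R.θ a b)) = N.bb₁ (laxT2 G f) (laxθ G a b) := by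
  rw [laxT3, ((R.θ_univ a b).bij₂ _ _).1 (R.exists_bb₁ (M.bb₁ f (R.θ a b))).choose_spec]

theorem laxT4_tb₁_θ {a b c d e : C} (f : M.T3 (R.m a b) c d e) :
    laxT4 G (M.tb₁ f (R.θ a b)) = N.tb₁ (laxT3 G f) (laxθ G a b) := by
  rw [laxT4, ((R.θ_univ a b).bij₃ _ _ _).1 (R.exists_tb₁ (M.tb₁ f (R.θ a b))).choose_spec]

theorem laxL0_act_u {a : C} (f : R.i ⟶ a) :
    laxL0 G (M.L0.act f R.u) = N.L0.act (G.F.map f) (laxU G) := by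
  rw [laxL0, (R.u_univ.bij₀ _).1 (R.lift0_spec (M.L0.act f R.u))]

theorem laxL1_bn₁_u {a b : C} (f : M.T2 R.i a b) :
    laxL1 G (M.bn₁ f R.u) = N.bn₁ (laxT2 G f) (laxU G) := by
  rw [laxL1, (R.u_univ.bij₁ _ _).1 (R.exists_bn₁ (M.bn₁ f R.u)).choose_spec]

theorem laxL2_tn₁_u {a b c : C} (f : M.T3 R.i a b c) :
    laxL2 G (M.tn₁ f R.u) = N.tn₁ (laxT3 G f) (laxU G) := by
  rw [laxL2, (R.u_univ.bij₂ _ _ _).1 (R.exists_tn₁ (M.tn₁ f R.u)).choose_spec]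

theorem laxT2_θ (a b : C) : laxT2 G (R.θ a b) = laxθ G a b := by
  have h := laxT2_post_θ G (𝟙 (R.m a b))
  rwa [M.T2.act_id, G.F.map_id, N.T2.act_id] at h

theorem laxL0_u : laxL0 G R.u = laxU G := by
  have h := laxL0_act_u G (𝟙 R.i)
  rwa [M.L0.act_id, G.F.map_id, N.L0.act_id] at h

/-- Precomposing `θ` with `(p₁, p₂)` is the same as postcomposing it with their tensor product, so
naturality in the inputs reduces to naturality of `f₂`. -/
theorem laxT2_nat {a₁ a₁' a₂ a₂' c c' : C} (p₁ : a₁' ⟶ a₁) (p₂ : a₂' ⟶ a₂) (q : c ⟶ c')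
    (f : M.T2 a₁ a₂ c) :
    laxT2 G (M.T2.act p₁ p₂ q f) =
      N.T2.act (G.F.map p₁) (G.F.map p₂) (G.F.map q) (laxT2 G f) := by
  obtain ⟨k, rfl⟩ := R.exists_post f
  have h : M.T2.act p₁ p₂ q (M.T2.act (𝟙 _) (𝟙 _) k (R.θ a₁ a₂)) =
      M.T2.act (𝟙 _) (𝟙 _) (R.mMap p₁ p₂ ≫ k ≫ q) (R.θ a₁' a₂') := by
    rw [post2, R.mMap_spec, M.T2.act_act, M.T2.act_act]
    simp
  rw [h, laxT2_post_θ, laxT2_post_θ, G.F.map_comp, post2, map_mMap_laxθ, N.T2.act_act,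
    N.T2.act_act]
  simp

theorem laxT2_post {a b c c' : C} (q : c ⟶ c') (f : M.T2 a b c) :
    laxT2 G (M.T2.act (𝟙 _) (𝟙 _) q f) = N.T2.act (𝟙 _) (𝟙 _) (G.F.map q) (laxT2 G f) := by
  rw [laxT2_nat, G.F.map_id, G.F.map_id]

/-- With `g = k ∘ θ`, dinaturality moves `k` into `f` and leaves a substitution of the classifier,
where the formula holds by definition. -/
theorem laxT3_bb₁ {a₁ a₂ b₁ b₂ c : C} (f : M.T2 b₁ b₂ c) (g : M.T2 a₁ a₂ b₁) :
    laxT3 G (M.bb₁ f g) = N.bb₁ (laxT2 G f) (laxT2 G g) := by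
  obtain ⟨k, rfl⟩ := R.exists_post g
  rw [← M.bb₁_dinat, laxT3_bb₁_θ, laxT2_post_θ, ← N.bb₁_dinat, laxT2_nat, G.F.map_id, G.F.map_id]

theorem laxT3_nat {a₁ a₁' a₂ a₂' a₃ a₃' c c' : C} (p₁ : a₁' ⟶ a₁) (p₂ : a₂' ⟶ a₂)
    (p₃ : a₃' ⟶ a₃) (q : c ⟶ c') (f : M.T3 a₁ a₂ a₃ c) :
    laxT3 G (M.T3.act p₁ p₂ p₃ q f) =
      N.T3.act (G.F.map p₁) (G.F.map p₂) (G.F.map p₃) (G.F.map q) (laxT3 G f) := by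
  obtain ⟨k, rfl⟩ := R.exists_bb₁ f
  rw [← M.bb₁_nat, laxT3_bb₁, laxT3_bb₁, laxT2_nat, laxT2_nat, G.F.map_id, N.bb₁_nat]

/-- This is where the associativity axiom enters: decomposing both arguments reduces the claim to `θ
∘₂ θ`, which is `α` applied to the universal ternary map. -/
theorem laxT3_bb₂ {a₁ a₂ b₁ b₂ c : C} (f : M.T2 b₁ b₂ c) (g : M.T2 a₁ a₂ b₂) :
    laxT3 G (M.bb₂ f g) = N.bb₂ (laxT2 G f) (laxT2 G g) := by
  obtain ⟨k, rfl⟩ := R.exists_post g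
  -- Identities of the target are written as images of identities, so that naturality folds the
  -- action of `F k` back inside `laxT2`. Afterwards `k` is absorbed into `f` and only `g = θ`
  -- remains.
  rw [← M.bb₂_dinat, laxT2_post, ← N.bb₂_dinat, ← G.F.map_id, ← G.F.map_id, ← laxT2_nat]
  generalize M.T2.act _ k _ f = f
  obtain ⟨k, rfl⟩ := R.exists_post f
  rw [M.bb₂_post, laxT2_post, N.bb₂_post, ← R.α_spec, laxT3_nat, laxT3_nat, θ3, laxT3_bb₁,
    laxT2_θ, laxT2_θ, laxT2_θ, laxT2_θ]
  simp only [G.F.map_id]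
  rw [map_α_laxθ]

theorem laxT4_tb₁ {a₁ a₂ b₁ b₂ b₃ c : C} (f : M.T3 b₁ b₂ b₃ c) (g : M.T2 a₁ a₂ b₁) :
    laxT4 G (M.tb₁ f g) = N.tb₁ (laxT3 G f) (laxT2 G g) := by
  obtain ⟨k, rfl⟩ := R.exists_post g
  rw [← M.tb₁_dinat, laxT4_tb₁_θ, laxT2_post_θ, ← N.tb₁_dinat, laxT3_nat, G.F.map_id,
    G.F.map_id, G.F.map_id]

/-- No new axiom on `G` is needed in arity four. Here and in the next three lemmas, one argument is
written as `k ∘₁ θ`, and an associativity or interchange law turns the substitution into one already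
treated. -/
theorem laxT4_bt₁ {a₁ a₂ a₃ b₁ b₂ c : C} (f : M.T2 b₁ b₂ c) (g : M.T3 a₁ a₂ a₃ b₁) :
    laxT4 G (M.bt₁ f g) = N.bt₁ (laxT2 G f) (laxT3 G g) := by
  obtain ⟨k, rfl⟩ := R.exists_bb₁ g
  rw [M.ass_a₁₁, laxT4_tb₁, laxT3_bb₁, laxT3_bb₁, N.ass_a₁₁]

theorem laxT4_tb₂ {a₁ a₂ b₁ b₂ b₃ c : C} (f : M.T3 b₁ b₂ b₃ c) (g : M.T2 a₁ a₂ b₂) :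
    laxT4 G (M.tb₂ f g) = N.tb₂ (laxT3 G f) (laxT2 G g) := by
  obtain ⟨k, rfl⟩ := R.exists_bb₁ f
  rw [← M.ass_a₁₂, laxT4_bt₁, laxT3_bb₁, laxT3_bb₂, N.ass_a₁₂]

theorem laxT4_tb₃ {a₁ a₂ b₁ b₂ b₃ c : C} (f : M.T3 b₁ b₂ b₃ c) (g : M.T2 a₁ a₂ b₃) :
    laxT4 G (M.tb₃ f g) = N.tb₃ (laxT3 G f) (laxT2 G g) := by
  obtain ⟨k, rfl⟩ := R.exists_bb₁ f
  rw [M.comm_a, laxT4_tb₁, laxT3_bb₁, laxT3_bb₂, N.comm_a]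

theorem laxT4_bt₂ {a₁ a₂ a₃ b₁ b₂ c : C} (f : M.T2 b₁ b₂ c) (g : M.T3 a₁ a₂ a₃ b₂) :
    laxT4 G (M.bt₂ f g) = N.bt₂ (laxT2 G f) (laxT3 G g) := by
  obtain ⟨k, rfl⟩ := R.exists_bb₁ g
  rw [M.ass_a₂₁, laxT4_tb₂, laxT3_bb₁, laxT3_bb₂, N.ass_a₂₁]

theorem laxL0_nat {c c' : C} (q : c ⟶ c') (f : M.L0 c) :
    laxL0 G (M.L0.act q f) = N.L0.act (G.F.map q) (laxL0 G f) := by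
  obtain ⟨k, rfl⟩ := R.exists_act f
  rw [M.L0.act_act, laxL0_act_u, laxL0_act_u, N.L0.act_act, G.F.map_comp]

theorem laxL1_bn₁ {b₁ b₂ c : C} (f : M.T2 b₁ b₂ c) (w : M.L0 b₁) :
    laxL1 G (M.bn₁ f w) = N.bn₁ (laxT2 G f) (laxL0 G w) := by
  obtain ⟨k, rfl⟩ := R.exists_act w
  rw [← M.bn₁_dinat, laxL1_bn₁_u, laxL0_act_u, ← N.bn₁_dinat, laxT2_nat, G.F.map_id, G.F.map_id]

theorem laxL2_tn₁ {b₁ b₂ b₃ c : C} (f : M.T3 b₁ b₂ b₃ c) (w : M.L0 b₁) :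
    laxL2 G (M.tn₁ f w) = N.tn₁ (laxT3 G f) (laxL0 G w) := by
  obtain ⟨k, rfl⟩ := R.exists_act w
  rw [← M.tn₁_dinat, laxL2_tn₁_u, laxL0_act_u, ← N.tn₁_dinat, laxT3_nat, G.F.map_id, G.F.map_id,
    G.F.map_id]

/-- Substituting a nullary map in the second slot yields a morphism, on which `F` itself acts. The
decompositions reduce the claim to `θ ∘₂ u = ρ`, and so to the right unit axiom. -/
theorem map_bn₂_lax {b₁ b₂ c : C} (f : M.T2 b₁ b₂ c) (w : M.L0 b₂) :
    G.F.map (M.bn₂ f w) = N.bn₂ (laxT2 G f) (laxL0 G w) := by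
  obtain ⟨k, rfl⟩ := R.exists_act w
  rw [← M.bn₂_dinat, laxL0_nat, ← N.bn₂_dinat, ← G.F.map_id, ← G.F.map_id, ← laxT2_nat]
  generalize M.T2.act _ k _ f = f
  obtain ⟨k, rfl⟩ := R.exists_post f
  rw [M.bn₂_post, laxT2_post, N.bn₂_post, laxT2_θ, laxL0_u, bn₂_laxθ_laxU, G.F.map_comp, ρ]

/-- The left unit axiom enters here. -/
theorem laxL1_j1 {a c : C} (f : a ⟶ c) : laxL1 G (M.j1 f) = N.j1 (G.F.map f) := by
  -- The defining equation of `λ`, postcomposed with `f`, exhibits `j f` as a tight binary map with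
  -- `u` substituted.
  have h : M.j1 f = M.bn₁ (M.T2.act (𝟙 _) (𝟙 _) (R.l a ≫ f) (R.θ R.i a)) R.u := by
    rw [M.bn₁_nat, postL1, R.l_spec, ← M.j1_nat]
    simp
  rw [h, laxL1_bn₁_u, laxT2_post_θ, N.bn₁_nat, G.F.map_comp, postL1, map_l_laxθ, ← N.j1_nat]
  simp

theorem laxL2_bu₁ {a b₁ b₂ c : C} (f : M.T2 b₁ b₂ c) (g : M.L1 a b₁) :
    laxL2 G (M.bu₁ f g) = N.bu₁ (laxT2 G f) (laxL1 G g) := by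
  obtain ⟨k, rfl⟩ := R.exists_bn₁ g
  rw [M.ass_b₁₁, laxL2_tn₁, laxT3_bb₁, laxL1_bn₁, N.ass_b₁₁]

theorem laxT2_tn₂ {b₁ b₂ b₃ c : C} (f : M.T3 b₁ b₂ b₃ c) (w : M.L0 b₂) :
    laxT2 G (M.tn₂ f w) = N.tn₂ (laxT3 G f) (laxL0 G w) := by
  obtain ⟨k, rfl⟩ := R.exists_bb₁ f
  rw [← M.ass_b₁₂, laxT2_nat, laxT3_bb₁, ← N.ass_b₁₂, G.F.map_id, G.F.map_id, map_bn₂_lax]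

theorem laxL1_nat {a a' c c' : C} (p : a' ⟶ a) (q : c ⟶ c') (f : M.L1 a c) :
    laxL1 G (M.L1.act p q f) = N.L1.act (G.F.map p) (G.F.map q) (laxL1 G f) := by
  obtain ⟨k, rfl⟩ := R.exists_bn₁ f
  rw [← M.bn₁_nat, laxL1_bn₁, laxL1_bn₁, laxT2_nat, G.F.map_id, N.bn₁_nat]

/-- The morphism of short skew multicategories induced by a lax monoidal functor. -/
noncomputable def ofLax : Hom M N where
  F := G.F
  T2 := laxT2 G
  T3 := laxT3 G
  T4 := laxT4 G
  L0 := laxL0 G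
  L1 := laxL1 G
  L2 := laxL2 G
  T2_nat := laxT2_nat G
  T3_nat := laxT3_nat G
  T4_nat p₁ p₂ p₃ p₄ q f := by
    obtain ⟨k, rfl⟩ := R.exists_tb₁ f
    rw [← M.tb₁_nat, laxT4_tb₁, laxT4_tb₁, laxT3_nat, laxT2_nat, G.F.map_id, N.tb₁_nat]
  L0_nat := laxL0_nat G
  L1_nat := laxL1_nat G
  L2_nat p₁ p₂ q f := by
    obtain ⟨k, rfl⟩ := R.exists_tn₁ f
    rw [← M.tn₁_nat, laxL2_tn₁, laxL2_tn₁, laxT3_nat, G.F.map_id, N.tn₁_nat]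
  map_j1 := laxL1_j1 G
  map_j2 {a b c} f := by
    -- Since `j f = f ∘₁ j(1)`, preservation of `j` in arity two follows from arity one.
    have h := M.bu₁_j f (𝟙 a)
    have h' := N.bu₁_j (laxT2 G f) (𝟙 (G.F.obj a))
    rw [M.T2.act_id] at h
    rw [N.T2.act_id] at h'
    rw [← h, ← h', laxL2_bu₁, laxL1_j1, G.F.map_id]
  map_bb₁ := laxT3_bb₁ G
  map_bb₂ := laxT3_bb₂ G
  map_tb₁ := laxT4_tb₁ G
  map_tb₂ := laxT4_tb₂ G
  map_tb₃ := laxT4_tb₃ G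
  map_bt₁ := laxT4_bt₁ G
  map_bt₂ := laxT4_bt₂ G
  map_bn₁ := laxL1_bn₁ G
  map_bn₂ := map_bn₂_lax G
  map_tn₁ := laxL2_tn₁ G
  map_tn₂ := laxT2_tn₂ G
  map_tn₃ f w := by
    obtain ⟨k, rfl⟩ := R.exists_bb₁ f
    rw [M.comm_b, laxT2_post, map_bn₂_lax, laxT3_bb₁, N.comm_b]
  map_un f w := by
    obtain ⟨k, rfl⟩ := R.exists_bn₁ f
    rw [M.comm_d, laxL0_nat, map_bn₂_lax, laxL1_bn₁, N.comm_d]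
  map_bu₁ := laxL2_bu₁ G
  map_bu₂ f g := by
    obtain ⟨k, rfl⟩ := R.exists_bn₁ g
    rw [M.ass_b₂₁, laxT2_tn₂, laxT3_bb₂, laxL1_bn₁, N.ass_b₂₁]
  map_ub f g := by
    obtain ⟨k, rfl⟩ := R.exists_bn₁ f
    rw [M.comm_c, laxL2_tn₁, laxT3_bb₂, laxL1_bn₁, N.comm_c]

/-- The structure maps of the induced lax functor are determined by the images of `u` and `θ`, and
`ofLax` sends these to `f₀ ∘ u` and `f₂ ∘ θ`. -/
theorem lax_ofLax : R.lax R' (ofLax G) = G := by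
  apply SkewMonoidal.Lax.ext
  · rfl
  · apply heq_of_eq
    apply (R'.u_univ.bij₀ _).1
    exact (R.f0_spec R' (ofLax G)).trans (laxL0_u G)
  · apply heq_of_eq
    funext a b
    apply R'.ext2
    exact (R.f2_spec R' (ofLax G) a b).trans (laxT2_θ G a b)

/-- Evaluated at the universal ternary map, the braiding condition on the lax functor says that `K`
commutes with `β³₂` on `θ3`; naturality spreads this to all ternary maps. The axioms for `g ∘₁
β³₂(f)` and `β³₂(g) ∘₁ f` then express `β⁴₂` and `β⁴₃` through `β³₂`. -/
theorem isBraided_of_lax {K : Hom M N} {B : M.ShortBraiding} {B' : N.ShortBraiding}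
    (h : (R.lax R' K).IsBraided (R.braiding B) (R'.braiding B')) : K.IsBraided B B' := by
  have h3 : ∀ {a₁ a₂ a₃ c : C} (f : M.T3 a₁ a₂ a₃ c), K.T3 (B.β32 f) = B'.β32 (K.T3 f) := by
    intro a b c d f
    obtain ⟨q, rfl⟩ := (R.bij_θ3 a b c d).2 f
    dsimp only
    have e : R'.s B' (K.F.obj a) (K.F.obj c) (K.F.obj b) ≫
        R'.mMap (R.f2 R' K a b) (𝟙 (K.F.obj c)) ≫ R.f2 R' K (R.m a b) c =
      R'.mMap (R.f2 R' K a c) (𝟙 (K.F.obj b)) ≫ R.f2 R' K (R.m a c) b ≫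
        K.F.map (R.s B a c b) := h a c b
    have e' := congrArg (fun k => N.T3.act (𝟙 _) (𝟙 _) (𝟙 _) k (R'.θ3 _ _ _)) e
    rw [post3, R'.s_spec, ← B'.β32_nat, f2_θ3, ← Category.assoc, post3, f2_θ3, ← map_post3,
      R.s_spec] at e'
    rw [B.β32_nat, map_post3, map_post3, B'.β32_nat, e']
  refine ⟨h3, fun {a₁ a₂ a₃ a₄ c} f => ?_, fun {a₁ a₂ a₃ a₄ c} f => ?_⟩
  · obtain ⟨k, rfl⟩ := R.exists_tb₁ f
    -- A second decomposition gives `(k ∘₁ θ) ∘₁ θ = k ∘₁ (θ ∘₁ θ)`, a ternary map inside a binary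
    -- one, on which `β⁴₂` acts as `β³₂` inside.
    obtain ⟨k, rfl⟩ := R.exists_bb₁ k
    rw [← M.ass_a₁₁, ← B.bt₁_β, K.map_bt₁, h3, B'.bt₁_β, K.map_bt₁]
  · obtain ⟨k, rfl⟩ := R.exists_tb₁ f
    rw [B.tb₁_β, K.map_tb₁, h3, ← B'.tb₁_β, K.map_tb₁]

end Classifiers
end ShortSkewMulti

/-! ### Full faithfulness of the braided functor -/

theorem Kbrd_full (R : ClassifierChoice.{v, u}) : (Kbrd R).Full where
  map_surjective {X Y} G := by
    let K := ShortSkewMulti.Classifiers.ofLax (R := R X.obj.toFSMulti X.property)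
      (R' := R Y.obj.toFSMulti Y.property) G.hom
    have hK : (R X.obj.toFSMulti X.property).lax (R Y.obj.toFSMulti Y.property) K = G.hom :=
      ShortSkewMulti.Classifiers.lax_ofLax _
    refine ⟨ObjectProperty.homMk ⟨K, ShortSkewMulti.Classifiers.isBraided_of_lax
      (R := R X.obj.toFSMulti X.property) (R' := R Y.obj.toFSMulti Y.property) ?_⟩,
      BrdSkMon.Hom.ext hK⟩
    rw [hK]
    exact G.isBraided

theorem Kbrd_faithful (R : ClassifierChoice.{v, u}) : (Kbrd R).Faithful where
  map_injective {X Y} G H h := by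
    apply ObjectProperty.hom_ext
    exact BrdFSMulti.Hom.ext (ShortSkewMulti.Classifiers.hom_ext
      (R X.obj.toFSMulti X.property) (R Y.obj.toFSMulti Y.property)
      (congrArg BrdSkMon.Hom.hom h))

/-! ### From skew monoidal categories back to short skew multicategories -/

namespace SkewMonoidal

variable {C : Type u} [Category.{v} C] (S : SkewMonoidal C)

/-! ### Whiskering -/

/-- Right whiskering `f ↦ fb`. -/
def wr {a a' : C} (f : a ⟶ a') (b : C) : S.m a b ⟶ S.m a' b := S.mMap f (𝟙 b)

/-- Left whiskering `g ↦ ag`. -/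
def wl (a : C) {b b' : C} (g : b ⟶ b') : S.m a b ⟶ S.m a b' := S.mMap (𝟙 a) g

/-- Splitting tensor products into whiskerings gives `simp` a normal form: right whiskerings come
before left ones, and naturality pushes arbitrary morphisms in front of `α` and `ρ` but behind `λ`.
-/
theorem mMap_eq {a a' b b' : C} (f : a ⟶ a') (g : b ⟶ b') :
    S.mMap f g = S.wr f b ≫ S.wl a' g := by
  rw [wr, wl, ← S.mMap_comp, Category.id_comp, Category.comp_id]

@[simp] theorem wr_id (a b : C) : S.wr (𝟙 a) b = 𝟙 _ := S.mMap_id a b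

@[simp] theorem wl_id (a b : C) : S.wl a (𝟙 b) = 𝟙 _ := S.mMap_id a b

@[simp] theorem wr_comp {a a' a'' : C} (f : a ⟶ a') (f' : a' ⟶ a'') (b : C) :
    S.wr (f ≫ f') b = S.wr f b ≫ S.wr f' b := S.mMap_comp_id f f' b

@[simp] theorem wl_comp (a : C) {b b' b'' : C} (g : b ⟶ b') (g' : b' ⟶ b'') :
    S.wl a (g ≫ g') = S.wl a g ≫ S.wl a g' := S.mMap_id_comp a g g'

theorem comp_comp_eq {a b b' c d : C} {f : a ⟶ b} {g : b ⟶ c} {f' : a ⟶ b'} {g' : b' ⟶ c}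
    (h : f ≫ g = f' ≫ g') (k : c ⟶ d) : f ≫ g ≫ k = f' ≫ g' ≫ k := by
  rw [← Category.assoc, h, Category.assoc]

theorem wr_wr_eq {a b b' c : C} {f : a ⟶ b} {g : b ⟶ c} {f' : a ⟶ b'} {g' : b' ⟶ c}
    (h : f ≫ g = f' ≫ g') (e : C) : S.wr f e ≫ S.wr g e = S.wr f' e ≫ S.wr g' e := by
  rw [← S.wr_comp, h, S.wr_comp]

theorem wl_wr {a a' b b' : C} (f : a ⟶ a') (g : b ⟶ b') :
    S.wl a g ≫ S.wr f b' = S.wr f b ≫ S.wl a' g := by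
  rw [← mMap_eq, wr, wl, ← S.mMap_comp, Category.id_comp, Category.comp_id]

theorem α_wr {a a' : C} (f : a ⟶ a') (b c : C) :
    S.α a b c ≫ S.wr f (S.m b c) = S.wr (S.wr f b) c ≫ S.α a' b c := by
  have h := S.α_nat f (𝟙 b) (𝟙 c)
  rw [S.mMap_id] at h
  exact h.symm

theorem α_wl_wr (a : C) {b b' : C} (f : b ⟶ b') (c : C) :
    S.α a b c ≫ S.wl a (S.wr f c) = S.wr (S.wl a f) c ≫ S.α a b' c :=
  (S.α_nat (𝟙 a) f (𝟙 c)).symm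

theorem α_wl_wl (a b : C) {c c' : C} (f : c ⟶ c') :
    S.α a b c ≫ S.wl a (S.wl b f) = S.wl (S.m a b) f ≫ S.α a b c' := by
  have h := S.α_nat (𝟙 a) (𝟙 b) f
  rw [S.mMap_id] at h
  exact h.symm

theorem wl_l {a a' : C} (f : a ⟶ a') : S.wl S.i f ≫ S.l a' = S.l a ≫ f := S.l_nat f

theorem ρ_wr {a a' : C} (f : a ⟶ a') : S.ρ a ≫ S.wr f S.i = f ≫ S.ρ a' := (S.ρ_nat f).symm

/-! Reassociated forms, also under right whiskering, oriented as simplification rules. -/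

section

variable {a a' b b' c c' d e e' : C}

@[simp] theorem wl_wr_assoc (f : a ⟶ a') (g : b ⟶ b') (k : S.m a' b' ⟶ d) :
    S.wl a g ≫ S.wr f b' ≫ k = S.wr f b ≫ S.wl a' g ≫ k :=
  comp_comp_eq (S.wl_wr f g) k

@[simp] theorem wl_wr_wr (f : a ⟶ a') (g : b ⟶ b') (k : S.m (S.m a' b') e ⟶ d) :
    S.wr (S.wl a g) e ≫ S.wr (S.wr f b') e ≫ k = S.wr (S.wr f b) e ≫ S.wr (S.wl a' g) e ≫ k :=
  comp_comp_eq (S.wr_wr_eq (S.wl_wr f g) e) k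

@[simp] theorem wl_wr_wr_wr (f : a ⟶ a') (g : b ⟶ b') (k : S.m (S.m (S.m a' b') e) e' ⟶ d) :
    S.wr (S.wr (S.wl a g) e) e' ≫ S.wr (S.wr (S.wr f b') e) e' ≫ k =
      S.wr (S.wr (S.wr f b) e) e' ≫ S.wr (S.wr (S.wl a' g) e) e' ≫ k :=
  comp_comp_eq (S.wr_wr_eq (S.wr_wr_eq (S.wl_wr f g) e) e') k

@[simp] theorem α_wr_assoc (f : a ⟶ a') (k : S.m a' (S.m b c) ⟶ d) :
    S.α a b c ≫ S.wr f (S.m b c) ≫ k = S.wr (S.wr f b) c ≫ S.α a' b c ≫ k :=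
  comp_comp_eq (S.α_wr f b c) k

@[simp] theorem α_wr_wr (f : a ⟶ a') (k : S.m (S.m a' (S.m b c)) e ⟶ d) :
    S.wr (S.α a b c) e ≫ S.wr (S.wr f (S.m b c)) e ≫ k =
      S.wr (S.wr (S.wr f b) c) e ≫ S.wr (S.α a' b c) e ≫ k :=
  comp_comp_eq (S.wr_wr_eq (S.α_wr f b c) e) k

@[simp] theorem α_wl_wr_assoc (f : b ⟶ b') (k : S.m a (S.m b' c) ⟶ d) :
    S.α a b c ≫ S.wl a (S.wr f c) ≫ k = S.wr (S.wl a f) c ≫ S.α a b' c ≫ k :=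
  comp_comp_eq (S.α_wl_wr a f c) k

@[simp] theorem α_wl_wr_wr (f : b ⟶ b') (k : S.m (S.m a (S.m b' c)) e ⟶ d) :
    S.wr (S.α a b c) e ≫ S.wr (S.wl a (S.wr f c)) e ≫ k =
      S.wr (S.wr (S.wl a f) c) e ≫ S.wr (S.α a b' c) e ≫ k :=
  comp_comp_eq (S.wr_wr_eq (S.α_wl_wr a f c) e) k

@[simp] theorem α_wl_wl_assoc (f : c ⟶ c') (k : S.m a (S.m b c') ⟶ d) :
    S.α a b c ≫ S.wl a (S.wl b f) ≫ k = S.wl (S.m a b) f ≫ S.α a b c' ≫ k :=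
  comp_comp_eq (S.α_wl_wl a b f) k

@[simp] theorem α_wl_wl_wr (f : c ⟶ c') (k : S.m (S.m a (S.m b c')) e ⟶ d) :
    S.wr (S.α a b c) e ≫ S.wr (S.wl a (S.wl b f)) e ≫ k =
      S.wr (S.wl (S.m a b) f) e ≫ S.wr (S.α a b c') e ≫ k :=
  comp_comp_eq (S.wr_wr_eq (S.α_wl_wl a b f) e) k

@[simp] theorem wl_l_assoc (f : a ⟶ a') (k : a' ⟶ d) :
    S.wl S.i f ≫ S.l a' ≫ k = S.l a ≫ f ≫ k :=
  comp_comp_eq (S.wl_l f) k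

@[simp] theorem wl_l_wr (f : a ⟶ a') (k : S.m a' e ⟶ d) :
    S.wr (S.wl S.i f) e ≫ S.wr (S.l a') e ≫ k = S.wr (S.l a) e ≫ S.wr f e ≫ k :=
  comp_comp_eq (S.wr_wr_eq (S.wl_l f) e) k

@[simp] theorem ρ_wr_assoc (f : a ⟶ a') (k : S.m a' S.i ⟶ d) :
    S.ρ a ≫ S.wr f S.i ≫ k = f ≫ S.ρ a' ≫ k :=
  comp_comp_eq (S.ρ_wr f) k

@[simp] theorem ρ_wr_wr (f : a ⟶ a') (k : S.m (S.m a' S.i) e ⟶ d) :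
    S.wr (S.ρ a) e ≫ S.wr (S.wr f S.i) e ≫ k = S.wr f e ≫ S.wr (S.ρ a') e ≫ k :=
  comp_comp_eq (S.wr_wr_eq (S.ρ_wr f) e) k

/-- The pentagon and the four unit axioms stay outside the `simp` set. Each is needed for just one
law of `toMulti`: `ass_a₂₂` here, then `ub_j`, `ass_b₂₂`, `bu₂_j` and `un_j` for the lemmas below.
All other laws are functoriality and naturality. -/
theorem pentagon_assoc (k : S.m a (S.m b (S.m c d)) ⟶ e) :
    S.wr (S.α a b c) d ≫ S.α a (S.m b c) d ≫ S.wl a (S.α b c d) ≫ k =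
      S.α (S.m a b) c d ≫ S.α a b (S.m c d) ≫ k := by
  rw [comp_comp_eq (S.pentagon a b c d) k, Category.assoc]
  rfl

theorem α_l_assoc (k : S.m a b ⟶ d) :
    S.α S.i a b ≫ S.l (S.m a b) ≫ k = S.wr (S.l a) b ≫ k := by
  rw [← Category.assoc, S.ax_iab, wr]

theorem ρ_α_assoc (k : S.m a (S.m b S.i) ⟶ d) :
    S.ρ (S.m a b) ≫ S.α a b S.i ≫ k = S.wl a (S.ρ b) ≫ k := by
  rw [← Category.assoc, S.ax_abi, wl]

theorem ρ_α_l_assoc (k : S.m a b ⟶ d) :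
    S.wr (S.ρ a) b ≫ S.α a S.i b ≫ S.wl a (S.l b) ≫ k = k := by
  have h := S.ax_aib a b
  rw [← Category.id_comp k, ← h]
  simp only [Category.assoc, wr, wl]
  rw [reassoc_of% h]

theorem ρ_l_assoc (k : S.i ⟶ d) : S.ρ S.i ≫ S.l S.i ≫ k = k := by
  rw [← Category.assoc, S.ax_ii, Category.id_comp]

end

/-! ### The short skew multicategory of a skew monoidal category -/

/-- Multimaps `(a₁, …, aₙ) → c` are morphisms out of the left bracketed tensor product of
`a₁, …, aₙ`, with an additional unit in the first place if they are loose. -/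
def toMulti : ShortSkewMulti C where
  T2 :=
    { hom a b c := S.m a b ⟶ c
      act p₁ p₂ q f := S.mMap p₁ p₂ ≫ f ≫ q
      act_id f := by simp [mMap_eq]
      act_act p₁ p₁' p₂ p₂' q q' f := by simp [mMap_eq] }
  T3 :=
    { hom a b c d := S.m (S.m a b) c ⟶ d
      act p₁ p₂ p₃ q f := S.mMap (S.mMap p₁ p₂) p₃ ≫ f ≫ q
      act_id f := by simp [mMap_eq]
      act_act _ _ _ _ _ _ _ _ _ := by simp [mMap_eq] }
  T4 :=
    { hom a b c d e := S.m (S.m (S.m a b) c) d ⟶ e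
      act p₁ p₂ p₃ p₄ q f := S.mMap (S.mMap (S.mMap p₁ p₂) p₃) p₄ ≫ f ≫ q
      act_id f := by simp [mMap_eq]
      act_act _ _ _ _ _ _ _ _ _ := by simp [mMap_eq] }
  L0 :=
    { hom c := S.i ⟶ c
      act q f := f ≫ q
      act_id f := by simp
      act_act _ _ _ := by simp }
  L1 :=
    { hom a c := S.m S.i a ⟶ c
      act p q f := S.wl S.i p ≫ f ≫ q
      act_id f := by simp
      act_act _ _ _ _ _ := by simp }
  L2 :=
    { hom a b c := S.m (S.m S.i a) b ⟶ c
      act p₁ p₂ q f := S.mMap (S.wl S.i p₁) p₂ ≫ f ≫ q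
      act_id f := by simp [mMap_eq]
      act_act _ _ _ _ _ _ _ := by simp [mMap_eq] }
  -- A tight map becomes loose by deleting the extra leading unit with `λ`.
  j1 f := S.l _ ≫ f
  j2 f := S.wr (S.l _) _ ≫ f
  bb₁ f g := S.wr g _ ≫ f
  bb₂ f g := S.α _ _ _ ≫ S.wl _ g ≫ f
  tb₁ f g := S.wr (S.wr g _) _ ≫ f
  tb₂ f g := S.wr (S.α _ _ _ ≫ S.wl _ g) _ ≫ f
  tb₃ f g := S.α _ _ _ ≫ S.wl _ g ≫ f
  bt₁ f g := S.wr g _ ≫ f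
  -- Substitution beyond the first slot must move the inserted variables into one bracket: each `α`
  -- rebrackets one step, and a ternary map needs two.
  bt₂ f g := S.wr (S.α _ _ _) _ ≫ S.α _ _ _ ≫ S.wl _ g ≫ f
  bn₁ f w := S.wr w _ ≫ f
  bn₂ f w := S.ρ _ ≫ S.wl _ w ≫ f
  tn₁ f w := S.wr (S.wr w _) _ ≫ f
  tn₂ f w := S.wr (S.ρ _ ≫ S.wl _ w) _ ≫ f
  tn₃ f w := S.ρ _ ≫ S.wl _ w ≫ f
  un f w := S.ρ _ ≫ S.wl _ w ≫ f
  bu₁ f g := S.wr g _ ≫ f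
  -- The loose map needs a unit in front of its variable: `ρ` creates it, and `α` shifts it across,
  -- `b₁a → (b₁i)a → b₁(ia)`.
  bu₂ f g := S.wr (S.ρ _) _ ≫ S.α _ _ _ ≫ S.wl _ g ≫ f
  ub f g := S.α _ _ _ ≫ S.wl _ g ≫ f
  j1_nat _ _ _ := by simp
  j2_nat _ _ _ _ := by simp [mMap_eq]
  bu₂_j _ _ := by simp [mMap_eq, ρ_α_l_assoc]
  bu₁_j _ _ := by simp [mMap_eq]
  ub_j _ _ := by simp [mMap_eq, α_l_assoc]
  un_j _ _ := by simp [ρ_l_assoc]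
  bb₁_nat _ _ _ _ _ _ := by simp [mMap_eq]
  bb₁_dinat _ _ _ := by simp [mMap_eq]
  bb₂_nat _ _ _ _ _ _ := by simp [mMap_eq]
  bb₂_dinat _ _ _ := by simp [mMap_eq]
  tb₁_nat _ _ _ _ _ _ _ := by simp [mMap_eq]
  tb₁_dinat _ _ _ := by simp [mMap_eq]
  tb₂_nat _ _ _ _ _ _ _ := by simp [mMap_eq]
  tb₂_dinat _ _ _ := by simp [mMap_eq]
  tb₃_nat _ _ _ _ _ _ _ := by simp [mMap_eq]
  tb₃_dinat _ _ _ := by simp [mMap_eq]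
  bt₁_nat _ _ _ _ _ _ _ := by simp [mMap_eq]
  bt₁_dinat _ _ _ := by simp [mMap_eq]
  bt₂_nat _ _ _ _ _ _ _ := by simp [mMap_eq]
  bt₂_dinat _ _ _ := by simp [mMap_eq]
  bn₁_nat _ _ _ _ := by simp [mMap_eq]
  bn₁_dinat _ _ _ := by simp [mMap_eq]
  bn₂_nat _ _ _ _ := by simp [mMap_eq]
  bn₂_dinat _ _ _ := by simp [mMap_eq]
  tn₁_nat _ _ _ _ _ := by simp [mMap_eq]
  tn₁_dinat _ _ _ := by simp [mMap_eq]
  tn₂_nat _ _ _ _ _ := by simp [mMap_eq]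
  tn₂_dinat _ _ _ := by simp [mMap_eq]
  tn₃_nat _ _ _ _ _ := by simp [mMap_eq]
  tn₃_dinat _ _ _ := by simp [mMap_eq]
  un_nat _ _ _ := by simp
  un_dinat _ _ _ := by simp
  bu₁_nat _ _ _ _ _ := by simp [mMap_eq]
  bu₁_dinat _ _ _ := by simp [mMap_eq]
  bu₂_nat _ _ _ _ _ := by simp [mMap_eq]
  bu₂_dinat _ _ _ := by simp [mMap_eq]
  ub_nat _ _ _ _ _ := by simp [mMap_eq]
  ub_dinat _ _ _ := by simp [mMap_eq]
  ass_a₁₁ _ _ _ := by simp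
  ass_a₁₂ _ _ _ := by simp
  ass_a₂₁ _ _ _ := by simp
  ass_a₂₂ _ _ _ := by simp [pentagon_assoc]
  ass_b₁₁ _ _ _ := by simp
  ass_b₁₂ _ _ _ := by simp [mMap_eq]
  ass_b₂₁ _ _ _ := by simp
  -- The axiom is used backwards: replacing `b ρ` by `ρ` followed by `α` creates an associator past
  -- which the doubly whiskered nullary map can move.
  ass_b₂₂ _ _ _ := by simp [mMap_eq, ← ρ_α_assoc]
  comm_a _ _ _ := by simp
  comm_b _ _ _ := by simp [mMap_eq]
  comm_c _ _ _ := by simp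
  comm_d _ _ _ := by simp

end SkewMonoidal

/-! ### Recovering a braided skew monoidal category from its multimaps -/

namespace SkewMonoidal

variable {C : Type u} [Category.{v} C] (S : SkewMonoidal C)

theorem bijective_of_forall_eq {α : Sort*} {g : α → α} (h : ∀ x, g x = x) :
    Function.Bijective g := by
  rw [show g = id from funext h]
  exact Function.bijective_id

/-- The identities, as classifiers in the short skew multicategory of a skew monoidal category. -/
def classifiers : S.toMulti.Classifiers where
  i := S.i
  u := 𝟙 S.i
  u_univ :=
    { bij₀ d := bijective_of_forall_eq fun (f : S.i ⟶ d) => Category.id_comp f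
      bij₁ x d := bijective_of_forall_eq fun (f : S.m S.i x ⟶ d) => by
        change S.wr (𝟙 S.i) x ≫ f = f
        simp
      bij₂ x y d := bijective_of_forall_eq fun (f : S.m (S.m S.i x) y ⟶ d) => by
        change S.wr (S.wr (𝟙 S.i) x) y ≫ f = f
        simp }
  m := S.m
  θ a b := 𝟙 (S.m a b)
  θ_univ a b :=
    { bij₁ d := bijective_of_forall_eq fun (f : S.m a b ⟶ d) => by
        change S.mMap (𝟙 a) (𝟙 b) ≫ 𝟙 (S.m a b) ≫ f = f
        simp [S.mMap_id]
      bij₂ x d := bijective_of_forall_eq fun (f : S.m (S.m a b) x ⟶ d) => by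
        change S.wr (𝟙 (S.m a b)) x ≫ f = f
        simp
      bij₃ x y d := bijective_of_forall_eq fun (f : S.m (S.m (S.m a b) x) y ⟶ d) => by
        change S.wr (S.wr (𝟙 (S.m a b)) x) y ≫ f = f
        simp }

theorem toMulti_isLeftRepresentable : S.toMulti.IsLeftRepresentable :=
  ⟨⟨_, _, S.classifiers.u_univ⟩, fun a b => ⟨_, _, S.classifiers.θ_univ a b⟩⟩

@[ext]
theorem ext {S T : SkewMonoidal C} (hm : S.m = T.m) (hi : S.i = T.i)
    (hM : HEq (@S.mMap) (@T.mMap)) (hα : HEq S.α T.α) (hl : HEq S.l T.l) (hρ : HEq S.ρ T.ρ) :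
    S = T := by
  obtain ⟨m, M, _, _, i, α, l, ρ, _⟩ := S
  obtain ⟨m', M', _, _, i', α', l', ρ', _⟩ := T
  dsimp only at hm hi
  subst hm hi
  cases hM
  cases hα
  cases hl
  cases hρ
  rfl

theorem classifiers_θ3 (a b c : C) : S.classifiers.θ3 a b c = 𝟙 (S.m (S.m a b) c) := by
  change S.wr (𝟙 (S.m a b)) c ≫ 𝟙 (S.m (S.m a b) c) = _
  simp

/-- With identities as classifiers, the equations that characterise the tensor product of morphisms,
`α`, `λ` and `ρ` are satisfied by the original maps, so uniqueness gives equality and not merely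
isomorphism. -/
theorem classifiers_skewMonoidal : S.classifiers.skewMonoidal = S := by
  apply SkewMonoidal.ext
  · rfl
  · rfl
  · apply heq_of_eq
    funext a a' b b' f g
    apply S.classifiers.ext2
    refine (S.classifiers.mMap_spec f g).trans ?_
    change S.mMap f g ≫ 𝟙 (S.m a' b') ≫ 𝟙 (S.m a' b') =
      S.mMap (𝟙 a) (𝟙 b) ≫ 𝟙 (S.m a b) ≫ S.mMap f g
    simp [S.mMap_id]
  · apply heq_of_eq
    funext a b c
    apply S.classifiers.ext3
    refine (S.classifiers.α_spec a b c).trans ?_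
    rw [classifiers_θ3]
    change S.α a b c ≫ S.wl a (𝟙 (S.m b c)) ≫ 𝟙 (S.m a (S.m b c)) =
      S.mMap (S.mMap (𝟙 a) (𝟙 b)) (𝟙 c) ≫ 𝟙 (S.m (S.m a b) c) ≫ S.α a b c
    simp [S.mMap_id]
  · apply heq_of_eq
    funext a
    apply (S.classifiers.bij_θu a a).1
    refine (S.classifiers.l_spec a).trans ?_
    change S.l a ≫ 𝟙 a = S.wl S.i (𝟙 a) ≫ (S.wr (𝟙 S.i) a ≫ 𝟙 (S.m S.i a)) ≫ S.l a
    simp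
  · apply heq_of_eq
    funext a
    change S.ρ a ≫ S.wl a (𝟙 S.i) ≫ 𝟙 (S.m a S.i) = S.ρ a
    simp

theorem wr_hom_inv {a b : C} (e : a ≅ b) {c d : C} (f : S.m a c ⟶ d) :
    S.wr e.hom c ≫ S.wr e.inv c ≫ f = f := by
  rw [← Category.assoc, ← wr_comp, e.hom_inv_id, wr_id, Category.id_comp]

theorem wr_inv_hom {a b : C} (e : a ≅ b) {c d : C} (f : S.m b c ⟶ d) :
    S.wr e.inv c ≫ S.wr e.hom c ≫ f = f :=
  S.wr_hom_inv e.symm f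

variable {S}

theorem Braiding.s_wr_wl (B : S.Braiding) {x a b b' : C} (h : b ⟶ b') :
    (B.s x a b).hom ≫ S.wr (S.wl x h) a = S.wl (S.m x a) h ≫ (B.s x a b').hom := by
  have e := B.s_nat (𝟙 x) (𝟙 a) h
  rw [S.mMap_id] at e
  exact e.symm

theorem Braiding.s_wl (B : S.Braiding) {x a a' b : C} (g : a ⟶ a') :
    (B.s x a b).hom ≫ S.wl (S.m x b) g = S.wr (S.wl x g) b ≫ (B.s x a' b).hom := by
  have e := B.s_nat (𝟙 x) g (𝟙 b)
  rw [S.mMap_id] at e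
  exact e.symm

/-- The short braiding on the short skew multicategory of a braided skew monoidal category. -/
def Braiding.toShortBraiding (B : S.Braiding) : S.toMulti.ShortBraiding where
  β32 {a₁ a₂ a₃ c} :=
    -- Precomposition is contravariant, hence the exchanged indices: `s_{a₁,a₃,a₂}` runs from
    -- `(a₁a₃)a₂` to `(a₁a₂)a₃`.
    { toFun (f : S.m (S.m a₁ a₂) a₃ ⟶ c) := (B.s a₁ a₃ a₂).hom ≫ f
      invFun (f : S.m (S.m a₁ a₃) a₂ ⟶ c) := (B.s a₁ a₃ a₂).inv ≫ f
      left_inv (f : S.m (S.m a₁ a₂) a₃ ⟶ c) := Iso.inv_hom_id_assoc _ f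
      right_inv (f : S.m (S.m a₁ a₃) a₂ ⟶ c) := Iso.hom_inv_id_assoc _ f }
  β42 {a₁ a₂ a₃ a₄ c} :=
    { toFun (f : S.m (S.m (S.m a₁ a₂) a₃) a₄ ⟶ c) := S.wr (B.s a₁ a₃ a₂).hom a₄ ≫ f
      invFun (f : S.m (S.m (S.m a₁ a₃) a₂) a₄ ⟶ c) := S.wr (B.s a₁ a₃ a₂).inv a₄ ≫ f
      left_inv (f : S.m (S.m (S.m a₁ a₂) a₃) a₄ ⟶ c) := S.wr_inv_hom _ f
      right_inv (f : S.m (S.m (S.m a₁ a₃) a₂) a₄ ⟶ c) := S.wr_hom_inv _ f }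
  β43 {a₁ a₂ a₃ a₄ c} :=
    { toFun (f : S.m (S.m (S.m a₁ a₂) a₃) a₄ ⟶ c) := (B.s (S.m a₁ a₂) a₄ a₃).hom ≫ f
      invFun (f : S.m (S.m (S.m a₁ a₂) a₄) a₃ ⟶ c) := (B.s (S.m a₁ a₂) a₄ a₃).inv ≫ f
      left_inv (f : S.m (S.m (S.m a₁ a₂) a₃) a₄ ⟶ c) := Iso.inv_hom_id_assoc _ f
      right_inv (f : S.m (S.m (S.m a₁ a₂) a₄) a₃ ⟶ c) := Iso.hom_inv_id_assoc _ f }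
  β32_nat {a₁ a₁' a₂ a₂' a₃ a₃' c c'} p₁ p₂ p₃ q (f : S.m (S.m a₁ a₂) a₃ ⟶ c) := by
    change (B.s a₁' a₃' a₂').hom ≫ S.mMap (S.mMap p₁ p₂) p₃ ≫ f ≫ q =
      S.mMap (S.mMap p₁ p₃) p₂ ≫ ((B.s a₁ a₃ a₂).hom ≫ f) ≫ q
    rw [Category.assoc, comp_comp_eq (B.s_nat p₁ p₃ p₂)]
  β42_nat {a₁ a₁' a₂ a₂' a₃ a₃' a₄ a₄' c c'} p₁ p₂ p₃ p₄ q
      (f : S.m (S.m (S.m a₁ a₂) a₃) a₄ ⟶ c) := by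
    change S.wr (B.s a₁' a₃' a₂').hom a₄' ≫ S.mMap (S.mMap (S.mMap p₁ p₂) p₃) p₄ ≫ f ≫ q =
      S.mMap (S.mMap (S.mMap p₁ p₃) p₂) p₄ ≫ (S.wr (B.s a₁ a₃ a₂).hom a₄ ≫ f) ≫ q
    rw [S.mMap_eq _ p₄, S.mMap_eq _ p₄]
    simp only [Category.assoc, wl_wr_assoc]
    rw [comp_comp_eq (S.wr_wr_eq (B.s_nat p₁ p₃ p₂) a₄')]
  β43_nat {a₁ a₁' a₂ a₂' a₃ a₃' a₄ a₄' c c'} p₁ p₂ p₃ p₄ q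
      (f : S.m (S.m (S.m a₁ a₂) a₃) a₄ ⟶ c) := by
    change (B.s (S.m a₁' a₂') a₄' a₃').hom ≫ S.mMap (S.mMap (S.mMap p₁ p₂) p₃) p₄ ≫ f ≫ q =
      S.mMap (S.mMap (S.mMap p₁ p₂) p₄) p₃ ≫ ((B.s (S.m a₁ a₂) a₄ a₃).hom ≫ f) ≫ q
    rw [Category.assoc, comp_comp_eq (B.s_nat (S.mMap p₁ p₂) p₄ p₃)]
  braid {a₁ a₂ a₃ a₄ c} (h : S.m (S.m (S.m a₁ a₂) a₃) a₄ ⟶ c) := by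
    -- The braided variables enter in reverse order because the composite starts at the fully
    -- permuted product `((a₁a₄)a₃)a₂`.
    have e := B.ax_sss a₁ a₄ a₃ a₂ =≫ h
    simp only [Category.assoc] at e
    exact e.symm
  bt₁_β {a₁ a₂ a₃ b₁ b₂ c} (g : S.m b₁ b₂ ⟶ c) (f : S.m (S.m a₁ a₂) a₃ ⟶ b₁) := by
    change S.wr ((B.s a₁ a₃ a₂).hom ≫ f) b₂ ≫ g = S.wr (B.s a₁ a₃ a₂).hom b₂ ≫ S.wr f b₂ ≫ g
    simp
  bt₂_β {a₁ a₂ a₃ b₁ b₂ c} (g : S.m b₁ b₂ ⟶ c) (f : S.m (S.m a₁ a₂) a₃ ⟶ b₂) := by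
    have e := B.ax_αs b₁ a₁ a₃ a₂ =≫ (S.wl b₁ f ≫ g)
    simp only [Category.assoc] at e
    change S.wr (S.α _ _ _) _ ≫ S.α _ _ _ ≫ S.wl b₁ ((B.s a₁ a₃ a₂).hom ≫ f) ≫ g = _
    rw [wl_comp, Category.assoc]
    exact e
  tb₁_β {a₁ a₂ b₁ b₂ b₃ c} (g : S.m (S.m b₁ b₂) b₃ ⟶ c) (f : S.m a₁ a₂ ⟶ b₁) :=
    comp_comp_eq (B.s_nat f (𝟙 b₃) (𝟙 b₂)).symm g
  tb₂_β {a₁ a₂ b₁ b₂ b₃ c} (g : S.m (S.m b₁ b₂) b₃ ⟶ c) (f : S.m a₁ a₂ ⟶ b₂) := by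
    -- The hexagon handles the substitution of the tensor product itself; naturality of `s` in its
    -- last variable then carries `f` across.
    have e := B.ax_sα₁ b₁ b₃ a₁ a₂ =≫ (S.wr (S.wl b₁ f) b₃ ≫ g)
    simp only [Category.assoc] at e
    rw [comp_comp_eq (B.s_wr_wl f)] at e
    change S.wr _ _ ≫ (B.s _ _ _).hom ≫ S.wr (S.α b₁ a₁ a₂ ≫ S.wl b₁ f) b₃ ≫ g = _
    rw [wr_comp, Category.assoc]
    exact e
  tb₃_β {a₁ a₂ b₁ b₂ b₃ c} (g : S.m (S.m b₁ b₂) b₃ ⟶ c) (f : S.m a₁ a₂ ⟶ b₃) := by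
    have e := B.ax_sα₂ b₁ a₁ a₂ b₂ =≫ (S.wl (S.m b₁ b₂) f ≫ g)
    simp only [Category.assoc] at e
    rw [comp_comp_eq (B.s_wl f)] at e
    change _ = S.wr (S.α b₁ a₁ a₂ ≫ S.wl b₁ f) b₂ ≫ (B.s b₁ b₃ b₂).hom ≫ g
    rw [wr_comp, Category.assoc]
    exact e

theorem Braiding.toShortBraiding_isSymmetry {B : S.Braiding} (hB : B.IsSymmetry) :
    B.toShortBraiding.IsSymmetry := by
  intro a b c d (f : S.m (S.m a b) c ⟶ d)
  change (B.s a b c).hom ≫ (B.s a c b).hom ≫ f = f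
  rw [hB, Iso.inv_hom_id_assoc]

/-- Both universal ternary maps are identities, and `β³₂` is precomposition with `s`, so the
defining equation of the induced braiding is solved by `s` itself. -/
theorem classifiers_braiding (B : S.Braiding) (x a b : C) :
    S.classifiers.s B.toShortBraiding x a b = (B.s x a b).hom := by
  apply S.classifiers.ext3
  refine (S.classifiers.s_spec _ x a b).trans ?_
  rw [classifiers_θ3, classifiers_θ3]
  change (B.s x a b).hom ≫ 𝟙 (S.m (S.m x b) a) =
    S.mMap (S.mMap (𝟙 x) (𝟙 a)) (𝟙 b) ≫ 𝟙 (S.m (S.m x a) b) ≫ (B.s x a b).hom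
  simp [S.mMap_id]

/-- Equal skew monoidal structures with equal braidings are isomorphic. -/
theorem nonempty_iso_of_eq {S T : SkewMonoidal C} (h : S = T) (B : S.Braiding) (B' : T.Braiding)
    (hB : ∀ x a b, HEq (B.s x a b).hom (B'.s x a b).hom) :
    Nonempty ((⟨⟨C, S⟩, B⟩ : BrdSkMon.{v, u}) ≅ ⟨⟨C, T⟩, B'⟩) := by
  subst h
  have e : B = B' := by
    obtain ⟨s, _⟩ := B
    obtain ⟨s', _⟩ := B'
    obtain rfl : s = s' := by
      funext x a b
      exact Iso.ext (eq_of_heq (hB x a b))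
    rfl
  subst e
  exact ⟨Iso.refl _⟩

end SkewMonoidal

namespace ShortSkewMulti.Classifiers

variable {C : Type u} [Category.{v} C] {M : ShortSkewMulti C}

/-- Two choices of classifiers give isomorphic braided skew monoidal categories. -/
noncomputable def compareIso (R R' : M.Classifiers) (B : M.ShortBraiding) :
    (⟨⟨C, R.skewMonoidal⟩, R.braiding B⟩ : BrdSkMon.{v, u}) ≅
      ⟨⟨C, R'.skewMonoidal⟩, R'.braiding B⟩ where
  -- Both directions come from the identity morphism of `M`, read through different classifiers;
  -- functoriality makes them mutually inverse.
  hom := ⟨R.lax R' (Hom.id M),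
    R.lax_isBraided R' _ ⟨fun _ => rfl, fun _ => rfl, fun _ => rfl⟩⟩
  inv := ⟨R'.lax R (Hom.id M),
    R'.lax_isBraided R _ ⟨fun _ => rfl, fun _ => rfl, fun _ => rfl⟩⟩
  hom_inv_id := BrdSkMon.Hom.ext
    ((R.lax_comp R' (Hom.id M) R (Hom.id M)).symm.trans R.lax_id)
  inv_hom_id := BrdSkMon.Hom.ext
    ((R'.lax_comp R (Hom.id M) R' (Hom.id M)).symm.trans R'.lax_id)

end ShortSkewMulti.Classifiers

/-- The left representable braided short skew multicategory of a braided skew monoidal category. -/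
def BrdSkMon.toMulti (Y : BrdSkMon.{v, u}) : BrdFSMultiLR.{v, u} :=
  ⟨⟨⟨Y.C, Y.S.toMulti⟩, Y.B.toShortBraiding⟩, Y.S.toMulti_isLeftRepresentable⟩

/-- The choice `R` need not pick the identity classifiers, so the object is first compared with the
one they define; that one has the structure and braiding of `Y`. -/
theorem nonempty_Kbrd_toMulti_iso (R : ClassifierChoice.{v, u}) (Y : BrdSkMon.{v, u}) :
    Nonempty ((Kbrd R).obj Y.toMulti ≅ Y) := by
  obtain ⟨e⟩ := SkewMonoidal.nonempty_iso_of_eq Y.S.classifiers_skewMonoidal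
    (Y.S.classifiers.braiding Y.B.toShortBraiding) Y.B
    (fun x a b => heq_of_eq (SkewMonoidal.classifiers_braiding Y.B x a b))
  exact ⟨ShortSkewMulti.Classifiers.compareIso
    (R Y.toMulti.obj.toFSMulti Y.toMulti.property) Y.S.classifiers Y.B.toShortBraiding ≪≫ e⟩

/-! ### The symmetric case and the conclusion -/

/-- The functor forgetting that a short braiding is a symmetry. -/
def forgetSymFSMulti : SymFSMultiLR.{v, u} ⥤ BrdFSMultiLR.{v, u} :=
  ObjectProperty.ιOfLE fun _ h => h.2

/-- `K^sym` followed by the inclusion into braided objects is the inclusion followed by `K^brd`.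
Both inclusions are fully faithful, so fullness, and likewise faithfulness, passes from `K^brd` to
`K^sym`. -/
theorem Ksym_full (R : ClassifierChoice.{v, u}) : (Ksym R).Full := by
  have := Kbrd_full R
  have : forgetSymFSMulti.{v, u}.Full := ObjectProperty.full_ιOfLE _
  exact Functor.Full.of_comp_faithful_iso (G := ObjectProperty.ι _)
    (Iso.refl (forgetSymFSMulti ⋙ Kbrd R))

theorem Ksym_faithful (R : ClassifierChoice.{v, u}) : (Ksym R).Faithful := by
  have := Kbrd_faithful R
  have : forgetSymFSMulti.{v, u}.Faithful := ObjectProperty.faithful_ιOfLE _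
  exact Functor.Faithful.of_comp_iso (G := ObjectProperty.ι _)
    (Iso.refl (forgetSymFSMulti ⋙ Kbrd R))

theorem Kbrd_isEquivalence (R : ClassifierChoice.{v, u}) : (Kbrd R).IsEquivalence where
  full := Kbrd_full R
  faithful := Kbrd_faithful R
  essSurj := ⟨fun Y => ⟨_, nonempty_Kbrd_toMulti_iso R Y⟩⟩

theorem Ksym_isEquivalence (R : ClassifierChoice.{v, u}) : (Ksym R).IsEquivalence where
  full := Ksym_full R
  faithful := Ksym_faithful R
  essSurj := ⟨fun Y => by
    -- The braided preimage of a symmetric object is itself symmetric, so the isomorphism already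
    -- found lies in the full subcategory.
    obtain ⟨e⟩ := nonempty_Kbrd_toMulti_iso R Y.obj
    exact ⟨⟨Y.obj.toMulti.obj,
      SkewMonoidal.Braiding.toShortBraiding_isSymmetry Y.property, Y.obj.toMulti.property⟩,
      ⟨ObjectProperty.isoMk _ e⟩⟩⟩

end ShortSkew

theorem mainTheorem7 (R : ShortSkew.ClassifierChoice.{v, u}) :
    (ShortSkew.Kbrd R).IsEquivalence ∧ (ShortSkew.Ksym R).IsEquivalence :=
  ⟨ShortSkew.Kbrd_isEquivalence R, ShortSkew.Ksym_isEquivalence R⟩
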